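/- Let $k$ be a field. For $\theta\in S^1$ and $\xi_1,\xi_2\in\mathbb C$ write $\xi_1<_\theta\xi_2$ if $\operatorname{Re}(\xi_1e^{-i\theta})<\operatorname{Re}(\xi_2e^{-i\theta})$. For $\xi\in\mathbb C$ let $i_\xi\colon S^1\to\mathbb C^*$, $\theta\mapsto e^{\operatorname{Re}(\xi e^{-i\theta})}e^{i\theta}$, let $S_\xi$ be its image, and for $z=\lambda e^{i\theta}\in\mathbb C^*$ write $S_\xi<z$ if $\lambda>e^{\operatorname{Re}(\xi e^{-i\theta})}$. Let $\pi\colon\mathbb C^*\to S^1$, $\lambda e^{i\theta}\mapsto\theta$. Local systems are locally constant sheaves of finite dimensional $k$-vector spaces. A co-Stokes structure of exponential type with exponents a finite set $E\subset\mathbb C$ is a local system $\mathcal L$ on $S^1$ with subsheaves $\mathcal L_{<\xi}$ $(\xi\in\mathbb C)$ such that $\xi_1<_\theta\xi_2$ implies $\mathcal L_{<\xi_1,\theta}\subset\mathcal L_{<\xi_2,\theta}$, and such that there are local systems $\operatorname{gr}_c\mathcal L$ $(c\in E)$ on $S^1$ for which, locally on $S^1$, $(\mathcal L,(\mathcal L_{<\xi})_\xi)$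 is isomorphic to $\bigoplus_{c\in E}\operatorname{gr}_c\mathcal L$ with the subsheaves $\bigoplus_{c\in E}j_!j^*\operatorname{gr}_c\mathcal L$, where $j$ is the inclusion of $\{\theta\mid c<_\theta\xi\}$ into $S^1$. Morphisms are the morphisms of sheaves compatible with all the subsheaves; $\mathrm{Sto}_<$ is the category of these objects for all finite sets $E$. A co-Stokes sheaf with exponents $E$ is a local system $\mathcal L$ on $\mathbb C^*$ with a subsheaf $\mathcal G$ such that each point of $\mathbb C^*$ has an open neighbourhood $U$ on which $\mathcal L$ is constant and has a decomposition $\mathcal L|_U=\bigoplus_{c\in E}\operatorname{gr}_c\mathcal L$ into constant sheaves with $\mathcal G_{z}=\bigoplus_{S_c<z}(\operatorname{gr}_c\mathcal L)_z$ for all $z\in U$. Morphisms are the morphisms of sheaves that map the subsheaves to each other; $\mathrm{SSh}$ is the category of these objects for all finite sets $E$. Theorem. (1) For a co-Stokes structure $(\mathcal L,\mathcal L_<)$ with exponents $E$, let $\mathcal G\subset\pi^*\mathcal L$ be the subsheaf of the sections whose germ at each $z$ lies in $\mathcal L_{<\xi,\pi(z)}\subset\mathcal L_{\pi(z)}=(\pi^*\mathcal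 L)_z$ for all $\xi$ with $z\in S_\xi$. Then $\mathcal G_z=\mathcal L_{<\xi,\pi(z)}$ whenever $z\in S_\xi$, the pair $(\pi^*\mathcal L,\mathcal G)$ is a co-Stokes sheaf with exponents $E$, and the functor $\sigma\colon\mathrm{Sto}_<\to\mathrm{SSh}$, $(\mathcal L,\mathcal L_<)\mapsto(\pi^*\mathcal L,\mathcal G)$, $f\mapsto\pi^*f$, is an equivalence of categories. (2) For a co-Stokes sheaf $(\mathcal L,\mathcal G)$ with exponents $E$ and a circle $S_\infty$ around $0$ encircling all $S_c$, $c\in E$, with $i_\infty\colon S^1\to S_\infty$ the rescaling, regard $i_\xi^*\mathcal G$ as a subsheaf of $i_\infty^*\mathcal L$ by identifying the stalks of $\mathcal L$ along each ray $\mathbb R_{>0}e^{i\theta}$. Then $(i_\infty^*\mathcal L,(i_\xi^*\mathcal G)_\xi)$ is a co-Stokes structure with exponents $E$, whose $\xi$-th subsheaf has stalk $\mathcal G_{i_\xi(\theta)}$ at $\theta$. For any choice of such a circle for each co-Stokes sheaf, this extends to a functor $\tau\colon\mathrm{SSh}\to\mathrm{Sto}_<$, given on morphisms by restriction to the circles $S_\infty$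 (circles of different radii being identified along the rays), and $\tau$ is a quasi-inverse of $\sigma$. -/

import Mathlib

open CategoryTheory TopologicalSpace Opposite

universe u

attribute [local instance 2000] CategoryTheory.CategoryStruct.toQuiver

noncomputable section

namespace CoStokes

/-! ### Sheaves of `k`-vector spaces and their subsheaves -/

section Sheaves

variable (k : Type u) [Field k]

/-- Sheaves of `k`-vector spaces on a topological space. -/
abbrev Sh (X : TopCat.{u}) := TopCat.Sheaf (ModuleCat.{u} k) X

variable {k} {X Y : TopCat.{u}}

/-- The vector space `F(U)`. -/
abbrev Sec (F : Sh k X) (U : Opens X) : ModuleCat.{u} k := F.presheaf.obj (op U)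

/-- The restriction map `F(U) → F(V)` for `V ⊆ U`. -/
def res (F : Sh k X) {U V : Opens X} (h : V ≤ U) : Sec F U →ₗ[k] Sec F V :=
  (F.presheaf.map (homOfLE h).op).hom

/-- The stalk `F_x`. -/
abbrev Stalk (F : Sh k X) (x : X) : ModuleCat.{u} k := TopCat.Presheaf.stalk F.presheaf x

/-- The germ map `F(U) → F_x` for `x ∈ U`. -/
def germ (F : Sh k X) (U : Opens X) (x : X) (hx : x ∈ U) : Sec F U →ₗ[k] Stalk F x :=
  (TopCat.Presheaf.germ F.presheaf U x hx).hom

/-- The map `F(U) → F'(U)` of a morphism of sheaves. -/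
def onSec {F F' : Sh k X} (f : F ⟶ F') (U : Opens X) : Sec F U →ₗ[k] Sec F' U :=
  (f.hom.app (op U)).hom

/-- The map `F_x → F'_x` of a morphism of sheaves. -/
def onStalk {F F' : Sh k X} (f : F ⟶ F') (x : X) : Stalk F x →ₗ[k] Stalk F' x :=
  ((TopCat.Presheaf.stalkFunctor (ModuleCat.{u} k) x).map f.hom).hom

lemma germ_res (F : Sh k X) {U V : Opens X} (h : V ≤ U) (x : X) (hx : x ∈ V) (s : Sec F U) :
    germ F V x hx (res F h s) = germ F U x (h hx) s :=
  TopCat.Presheaf.germ_res_apply F.presheaf (homOfLE h) x hx s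

lemma onStalk_germ {F F' : Sh k X} (f : F ⟶ F') (U : Opens X) (x : X) (hx : x ∈ U)
    (s : Sec F U) : onStalk f x (germ F U x hx s) = germ F' U x hx (onSec f U s) :=
  TopCat.Presheaf.stalkFunctor_map_germ_apply U x hx f.hom s

/-- A subsheaf (of vector spaces) of `F`. -/
@[ext]
structure Subsheaf (F : Sh k X) where
  sec : ∀ U : Opens X, Submodule k (Sec F U)
  res_mem : ∀ {U V : Opens X} (h : V ≤ U) {s : Sec F U}, s ∈ sec U → res F h s ∈ sec V
  mem_of_locally : ∀ {U : Opens X} (s : Sec F U),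
    (∀ x ∈ U, ∃ (V : Opens X) (h : V ≤ U), x ∈ V ∧ res F h s ∈ sec V) → s ∈ sec U

namespace Subsheaf

/-- The stalk `G_x`, as a subspace of `F_x`. -/
def stalk {F : Sh k X} (G : Subsheaf F) (x : X) : Submodule k (Stalk F x) where
  carrier := {a | ∃ (U : Opens X) (hx : x ∈ U), ∃ s ∈ G.sec U, germ F U x hx s = a}
  zero_mem' := ⟨⊤, trivial, 0, zero_mem _, map_zero _⟩
  add_mem' := by
    rintro _ _ ⟨U, hU, s, hs, rfl⟩ ⟨V, hV, t, ht, rfl⟩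
    have hx : x ∈ U ⊓ V := ⟨hU, hV⟩
    exact ⟨U ⊓ V, hx, res F inf_le_left s + res F inf_le_right t,
      add_mem (G.res_mem _ hs) (G.res_mem _ ht), by rw [map_add, germ_res, germ_res]⟩
  smul_mem' := by
    rintro a _ ⟨U, hU, s, hs, rfl⟩
    exact ⟨U, hU, a • s, Submodule.smul_mem _ _ hs, map_smul _ _ _⟩

/-- The subsheaf of the sections of `F` all of whose germs lie in given subspaces of the stalks. -/
def ofStalks (F : Sh k X) (P : ∀ x, Submodule k (Stalk F x)) : Subsheaf F where
  sec U :=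
    { carrier := {s | ∀ x (hx : x ∈ U), germ F U x hx s ∈ P x}
      zero_mem' := fun x hx => by rw [map_zero]; exact zero_mem _
      add_mem' := fun hs ht x hx => by rw [map_add]; exact add_mem (hs x hx) (ht x hx)
      smul_mem' := fun a s hs x hx => by
        rw [map_smul]; exact Submodule.smul_mem _ _ (hs x hx) }
  res_mem h _ hs x hx := by rw [germ_res]; exact hs x (h hx)
  mem_of_locally s hs x hx := by
    obtain ⟨V, h, hxV, hV⟩ := hs x hx
    have := hV x hxV
    rwa [germ_res] at this

end Subsheaf

open Classical in
/-- For `O` open with inclusion `j`, this is `j_! j^* F` as a subsheaf of `F`: the sections of `F`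
supported in `O`, that is, whose germs vanish outside `O`. -/
def extByZero (F : Sh k X) (O : Set X) : Subsheaf F :=
  Subsheaf.ofStalks F fun x => if x ∈ O then ⊤ else ⊥

/-- The inverse image functor `f^*` on sheaves. -/
abbrev pull (k : Type u) [Field k] (f : X ⟶ Y) : Sh k Y ⥤ Sh k X :=
  TopCat.Sheaf.pullback (ModuleCat.{u} k) f

/-- The canonical map `F_{f x} → (f^* F)_x`. -/
def pullStalk (f : X ⟶ Y) (F : Sh k Y) (x : X) :
    Stalk F (f x) →ₗ[k] Stalk ((pull k f).obj F) x :=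
  ((TopCat.Presheaf.stalkFunctor (ModuleCat.{u} k) (f x)).map
      ((TopCat.Sheaf.pullbackPushforwardAdjunction (ModuleCat.{u} k) f).unit.app F).hom ≫
    TopCat.Presheaf.stalkPushforward (ModuleCat.{u} k) f ((pull k f).obj F).presheaf x).hom

/-- The canonical map `F(U) → (f^* F)(f⁻¹ U)`. -/
def pullSec (f : X ⟶ Y) (F : Sh k Y) (U : Opens Y) :
    Sec F U →ₗ[k] Sec ((pull k f).obj F) ((Opens.map f).obj U) :=
  (((TopCat.Sheaf.pullbackPushforwardAdjunction (ModuleCat.{u} k) f).unit.app F).hom.app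
    (op U)).hom

lemma pullStalk_germ (f : X ⟶ Y) (F : Sh k Y) (x : X) (U : Opens Y) (hU : f x ∈ U)
    (hU' : x ∈ (Opens.map f).obj U) (s : Sec F U) :
    pullStalk f F x (germ F U (f x) hU s) =
      germ ((pull k f).obj F) ((Opens.map f).obj U) x hU' (pullSec f F U s) := by
  have h := TopCat.Presheaf.stalkFunctor_map_germ_apply U (f x) hU
    ((TopCat.Sheaf.pullbackPushforwardAdjunction (ModuleCat.{u} k) f).unit.app F).hom s
  have h' := ConcreteCategory.congr_hom (TopCat.Presheaf.stalkPushforward_germ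
    (ModuleCat.{u} k) f ((pull k f).obj F).presheaf U x hU) (pullSec f F U s)
  refine Eq.trans ?_ h'
  exact congrArg (TopCat.Presheaf.stalkPushforward (ModuleCat.{u} k) f
    ((pull k f).obj F).presheaf x).hom h

lemma onStalk_pullStalk (f : X ⟶ Y) {F F' : Sh k Y} (φ : F ⟶ F') (x : X)
    (a : Stalk F (f x)) :
    onStalk ((pull k f).map φ) x (pullStalk f F x a) = pullStalk f F' x (onStalk φ (f x) a) := by
  obtain ⟨U, hU, s, rfl⟩ := TopCat.Presheaf.exists_germ_eq F.presheaf a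
  have hU' : x ∈ (Opens.map f).obj U := hU
  change onStalk _ x (pullStalk f F x (germ F U (f x) hU s)) =
    pullStalk f F' x (onStalk φ (f x) (germ F U (f x) hU s))
  rw [pullStalk_germ f F x U hU hU', onStalk_germ, onStalk_germ, pullStalk_germ f F' x U hU hU']
  have h := (TopCat.Sheaf.pullbackPushforwardAdjunction (ModuleCat.{u} k) f).unit.naturality φ
  have h' : onSec ((pull k f).map φ) ((Opens.map f).obj U) (pullSec f F U s) =
      pullSec f F' U (onSec φ U s) := (congrArg (fun g => onSec g U s) h).symm
  rw [h']

/-- An isomorphism of `F|_U` with the constant sheaf on `U` with fibre `M`, the sheaf of locally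
constant functions with values in `M`. -/
structure ConstantOn (F : Sh k X) (U : Opens X) (M : ModuleCat.{u} k) where
  equiv : ∀ V : Opens X, V ≤ U → (Sec F V ≃ₗ[k] LocallyConstant V M)
  equiv_res : ∀ {V W : Opens X} (hV : V ≤ U) (hW : W ≤ V) (s : Sec F V) (x : W),
    equiv W (hW.trans hV) (res F hW s) x = equiv V hV s ⟨x.1, hW x.2⟩

/-- Local systems of finite dimensional vector spaces: locally constant sheaves with finite
dimensional fibres. -/
def IsLocalSystem (F : Sh k X) : Prop :=
  ∀ x : X, ∃ U : Opens X, x ∈ U ∧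
    ∃ M : ModuleCat.{u} k, Module.Finite k M ∧ Nonempty (ConstantOn F U M)

end Sheaves

/-! ### The spaces and the curves `S_ξ` -/

/-- The circle `S¹` (lifted to the universe of the field of coefficients). -/
abbrev S1 : TopCat.{u} := TopCat.of (ULift.{u} Circle)

/-- The punctured plane `ℂ*` (lifted to the universe of the field of coefficients). -/
abbrev Cstar : TopCat.{u} := TopCat.of (ULift.{u} {z : ℂ // z ≠ 0})

/-- `ξ₁ <_θ ξ₂`, that is `Re (ξ₁ e^{-iθ}) < Re (ξ₂ e^{-iθ})`, for the point `w = e^{iθ}`. -/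
def LtAt (w : S1.{u}) (ξ₁ ξ₂ : ℂ) : Prop :=
  (ξ₁ * (w.down : ℂ)⁻¹).re < (ξ₂ * (w.down : ℂ)⁻¹).re

/-- The projection `π : ℂ* → S¹`, `r e^{iθ} ↦ e^{iθ}`. -/
def proj : Cstar.{u} ⟶ S1.{u} :=
  TopCat.ofHom
    { toFun := fun z => ⟨⟨z.down.1 / ‖z.down.1‖, by
        have := z.down.2
        simp [Submonoid.unitSphere, this]⟩⟩
      continuous_toFun := by
        refine continuous_uliftUp.comp (Continuous.subtype_mk ?_ _)
        have h : Continuous fun z : Cstar.{u} => z.down.1 :=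
          continuous_subtype_val.comp continuous_uliftDown
        refine h.div (Complex.continuous_ofReal.comp h.norm) fun z => ?_
        simpa using z.down.2 }

/-- The inclusion `S¹ → ℂ*`, `e^{iθ} ↦ r e^{iθ}` of the circle of radius `r > 0` around `0`. -/
def circ (r : Set.Ioi (0 : ℝ)) : S1.{u} ⟶ Cstar.{u} :=
  TopCat.ofHom
    { toFun := fun w => ⟨⟨(r : ℝ) * (w.down : ℂ), by
        have : (r : ℝ) ≠ 0 := r.2.ne'
        simp [this]⟩⟩
      continuous_toFun := by
        refine continuous_uliftUp.comp (Continuous.subtype_mk ?_ _)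
        exact continuous_const.mul (continuous_subtype_val.comp continuous_uliftDown) }

/-- The parametrization `i_ξ : S¹ → ℂ*`, `e^{iθ} ↦ exp (Re (ξ e^{-iθ})) e^{iθ}` of `S_ξ`. -/
def param (ξ : ℂ) (w : S1.{u}) : Cstar.{u} :=
  ⟨⟨(Real.exp (ξ * (w.down : ℂ)⁻¹).re : ℝ) * (w.down : ℂ), by
    simp [-Complex.ofReal_exp, Real.exp_ne_zero]⟩⟩

/-- The curve `S_ξ ⊆ ℂ*`. -/
def curve (ξ : ℂ) : Set Cstar.{u} :=
  {z | ‖z.down.1‖ = Real.exp (ξ * ((proj z).down : ℂ)⁻¹).re}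

/-- `S_ξ < z`: the point `z` lies strictly outside the curve `S_ξ`. -/
def Outside (ξ : ℂ) (z : Cstar.{u}) : Prop :=
  Real.exp (ξ * ((proj z).down : ℂ)⁻¹).re < ‖z.down.1‖

/-- The open ray `ℝ_{>0} w` through `w ∈ S¹`. -/
def ray (w : S1.{u}) : Set Cstar.{u} := {z | proj z = w}

lemma proj_real_mul (a : ℝ) (ha : 0 < a) (w : S1.{u}) (h : (a : ℂ) * (w.down : ℂ) ≠ 0) :
    proj (⟨⟨(a : ℂ) * (w.down : ℂ), h⟩⟩ : Cstar.{u}) = w := by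
  apply ULift.ext
  apply Circle.ext
  change (a : ℂ) * (w.down : ℂ) / (‖(a : ℂ) * (w.down : ℂ)‖ : ℝ) = w.down
  have : (a : ℂ) ≠ 0 := by exact_mod_cast ha.ne'
  have h1 : ‖(w.down : ℂ)‖ = 1 := Circle.norm_coe _
  rw [norm_mul, h1, mul_one, Complex.norm_real, Real.norm_of_nonneg ha.le]
  field_simp

lemma circ_mem_ray (r : Set.Ioi (0 : ℝ)) (w : S1.{u}) : circ r w ∈ ray w :=
  proj_real_mul _ r.2 w _

lemma param_mem_ray (ξ : ℂ) (w : S1.{u}) : param ξ w ∈ ray w :=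
  proj_real_mul _ (Real.exp_pos _) w _

/-! ### Co-Stokes structures of exponential type -/

section Categories

variable (k : Type u) [Field k]

/-- A sheaf on `S¹` with a family of subsheaves `L_{<ξ}` indexed by `ξ ∈ ℂ`. -/
structure FilteredSheaf where
  L : Sh k S1.{u}
  fil : ℂ → Subsheaf L

/-- A sheaf on `ℂ*` with a subsheaf. -/
structure SheafPair where
  L : Sh k Cstar.{u}
  G : Subsheaf L

variable {k}

/-- Morphisms of sheaves on `S¹` compatible with the families of subsheaves. -/
@[ext]
structure FilteredSheaf.Hom (S T : FilteredSheaf k) where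
  hom : S.L ⟶ T.L
  map_fil : ∀ (ξ : ℂ) (U : Opens S1.{u}), ∀ s ∈ (S.fil ξ).sec U, onSec hom U s ∈ (T.fil ξ).sec U

instance : Category (FilteredSheaf k) where
  Hom := FilteredSheaf.Hom
  id S := ⟨𝟙 S.L, fun _ _ _ hs => hs⟩
  comp f g := ⟨f.hom ≫ g.hom, fun ξ U s hs => g.map_fil ξ U _ (f.map_fil ξ U s hs)⟩

/-- Morphisms of sheaves on `ℂ*` that restrict to the subsheaves. -/
@[ext]
structure SheafPair.Hom (S T : SheafPair k) where
  hom : S.L ⟶ T.L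
  map_sub : ∀ (U : Opens Cstar.{u}), ∀ s ∈ S.G.sec U, onSec hom U s ∈ T.G.sec U

instance : Category (SheafPair k) where
  Hom := SheafPair.Hom
  id S := ⟨𝟙 S.L, fun _ _ hs => hs⟩
  comp f g := ⟨f.hom ≫ g.hom, fun U s hs => g.map_sub U _ (f.map_sub U s hs)⟩

/-- An isomorphism over `U` of filtered sheaves between `(⨁_c gr_c, ⨁_c j_{ξ!} j_ξ^* gr_c)` and
`(L, L_{<ξ})`, where `j_ξ` is the inclusion of `{θ | c <_θ ξ}` into `S¹`. -/
structure GradedIsoOn (S : FilteredSheaf k) {E : Finset ℂ} (gr : E → Sh k S1.{u})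
    (U : Opens S1.{u}) where
  equiv : ∀ V : Opens S1.{u}, V ≤ U → ((∀ c : E, Sec (gr c) V) ≃ₗ[k] Sec S.L V)
  equiv_res : ∀ {V W : Opens S1.{u}} (hV : V ≤ U) (hW : W ≤ V) (t : ∀ c : E, Sec (gr c) V),
    equiv W (hW.trans hV) (fun c => res (gr c) hW (t c)) = res S.L hW (equiv V hV t)
  mem_fil_iff : ∀ (V : Opens S1.{u}) (hV : V ≤ U) (ξ : ℂ) (t : ∀ c : E, Sec (gr c) V),
    equiv V hV t ∈ (S.fil ξ).sec V ↔
      ∀ c : E, t c ∈ (extByZero (gr c) {w | LtAt w c ξ}).sec V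

/-- `(L, L_<)` is a co-Stokes structure of exponential type with exponents `E`. -/
structure FilteredSheaf.IsCoStokes (E : Finset ℂ) (S : FilteredSheaf k) : Prop where
  isLocalSystem : IsLocalSystem S.L
  stalk_mono : ∀ (w : S1.{u}) (ξ₁ ξ₂ : ℂ), LtAt w ξ₁ ξ₂ →
    (S.fil ξ₁).stalk w ≤ (S.fil ξ₂).stalk w
  graded : ∃ gr : E → Sh k S1.{u}, (∀ c, IsLocalSystem (gr c)) ∧
    ∀ w : S1.{u}, ∃ U : Opens S1.{u}, w ∈ U ∧ Nonempty (GradedIsoOn S gr U)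

/-! ### Co-Stokes sheaves -/

/-- A decomposition `L|_U = ⨁_c gr_c` into constant sheaves on `U` (with fibres `M c`) such that
`G_z = ⨁_{S_c < z} gr_c` for all `z ∈ U`. -/
structure DecompositionOn (S : SheafPair k) {E : Finset ℂ} (M : E → ModuleCat.{u} k)
    (U : Opens Cstar.{u}) where
  equiv : ∀ V : Opens Cstar.{u}, V ≤ U → (Sec S.L V ≃ₗ[k] ∀ c : E, LocallyConstant V (M c))
  equiv_res : ∀ {V W : Opens Cstar.{u}} (hV : V ≤ U) (hW : W ≤ V) (s : Sec S.L V) (c : E) (z : W),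
    equiv W (hW.trans hV) (res S.L hW s) c z = equiv V hV s c ⟨z.1, hW z.2⟩
  germ_mem_iff : ∀ (V : Opens Cstar.{u}) (hV : V ≤ U) (s : Sec S.L V) (z : V),
    germ S.L V z.1 z.2 s ∈ S.G.stalk z.1 ↔
      ∀ c : E, ¬ Outside (c : ℂ) z.1 → equiv V hV s c z = 0

/-- `(L, G)` is a co-Stokes sheaf with exponents `E`. -/
structure SheafPair.IsCoStokesSheaf (E : Finset ℂ) (S : SheafPair k) : Prop where
  isLocalSystem : IsLocalSystem S.L
  decomposition : ∀ z : Cstar.{u}, ∃ U : Opens Cstar.{u}, z ∈ U ∧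
    (∃ M : ModuleCat.{u} k, Nonempty (ConstantOn S.L U M)) ∧
    ∃ M : E → ModuleCat.{u} k, Nonempty (DecompositionOn S M U)

variable (k)

/-- The category of co-Stokes structures of exponential type. -/
abbrev Sto := ObjectProperty.FullSubcategory fun S : FilteredSheaf k => ∃ E, S.IsCoStokes E

/-- The category of co-Stokes sheaves. -/
abbrev SSh := ObjectProperty.FullSubcategory fun S : SheafPair k => ∃ E, S.IsCoStokesSheaf E

/-! ### The functor `σ` -/

variable {k}

/-- The subspace `L_{<ξ,θ}` of `(π^* L)_z`, for `z` with argument `θ`. -/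
def filAt (S : FilteredSheaf k) (ξ : ℂ) (z : Cstar.{u}) :
    Submodule k (Stalk ((pull k proj).obj S.L) z) :=
  ((S.fil ξ).stalk (proj z)).map (pullStalk proj S.L z)

/-- `(L, L_<) ↦ (π^* L, G)`, where `G` consists of the sections of `π^* L` whose germ at each `z`
lies in `L_{<ξ,θ}` for the `ξ` with `z ∈ S_ξ`. -/
def assemble (S : FilteredSheaf k) : SheafPair k where
  L := (pull k proj).obj S.L
  G := Subsheaf.ofStalks _ fun z => ⨅ (ξ : ℂ) (_ : z ∈ curve.{u} ξ), filAt S ξ z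

lemma onStalk_mem_stalk {S T : FilteredSheaf k} (f : S ⟶ T) (ξ : ℂ) (w : S1.{u})
    {a : Stalk S.L w} (ha : a ∈ (S.fil ξ).stalk w) : onStalk f.hom w a ∈ (T.fil ξ).stalk w := by
  obtain ⟨U, hU, s, hs, rfl⟩ := ha
  exact ⟨U, hU, _, f.map_fil ξ U s hs, (onStalk_germ f.hom U w hU s).symm⟩

variable (k) in
/-- Assembly as a functor, before restricting it to co-Stokes structures. -/
def assembleFunctor : FilteredSheaf k ⥤ SheafPair k where
  obj := assemble
  map {S T} f :=
    { hom := (pull k proj).map f.hom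
      map_sub := fun U s hs z hz => by
        have h := hs z hz
        have h' := onStalk_germ ((pull k proj).map f.hom) U z hz s
        simp only [Submodule.mem_iInf] at h ⊢
        intro ξ hξ
        obtain ⟨a, ha, he⟩ := h ξ hξ
        refine ⟨_, onStalk_mem_stalk f ξ _ ha, ?_⟩
        rw [← onStalk_pullStalk, he]
        exact h' }
  map_id S := SheafPair.Hom.ext ((pull k proj).map_id S.L)
  map_comp f g := SheafPair.Hom.ext ((pull k proj).map_comp f.hom g.hom)

/-- The functor `σ : Sto_< ⥤ SSh` obtained by restricting assembly to co-Stokes structures, given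
that it takes these to co-Stokes sheaves. -/
def sigma (h : ∀ (E : Finset ℂ) (S : FilteredSheaf k),
    S.IsCoStokes E → ((assembleFunctor k).obj S).IsCoStokesSheaf E) : Sto k ⥤ SSh k :=
  ObjectProperty.lift _ (ObjectProperty.ι _ ⋙ assembleFunctor k) fun S => by
    obtain ⟨E, hE⟩ := S.property
    exact ⟨E, h E S.obj hE⟩

/-! ### The functor `τ` -/

/-- The subspace of `L_x`, `x = r e^{iθ}`, that corresponds to `G_z ⊆ L_z`, `z = i_ξ(θ)`, under
`L_x ← L(I) → L_z`, where `I` is the ray through `x` and `z` and sections over `I` are given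
by sections over open neighbourhoods of `I`. -/
def transported (r : Set.Ioi (0 : ℝ)) (S : SheafPair k) (ξ : ℂ) (w : S1.{u}) :
    Submodule k (Stalk S.L (circ r w)) where
  carrier := {a | ∃ (U : Opens Cstar.{u}) (hU : ray w ⊆ U) (s : Sec S.L U),
    germ S.L U (circ r w) (hU (circ_mem_ray r w)) s = a ∧
    germ S.L U (param ξ w) (hU (param_mem_ray ξ w)) s ∈ S.G.stalk (param ξ w)}
  zero_mem' := ⟨⊤, fun _ _ => trivial, 0, map_zero _, by rw [map_zero]; exact zero_mem _⟩
  add_mem' := by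
    rintro _ _ ⟨U, hU, s, rfl, hs⟩ ⟨V, hV, t, rfl, ht⟩
    have h : ray w ⊆ (U ⊓ V : Opens Cstar.{u}) := fun z hz => ⟨hU hz, hV hz⟩
    refine ⟨U ⊓ V, h, res S.L inf_le_left s + res S.L inf_le_right t,
      by rw [map_add, germ_res, germ_res], ?_⟩
    rw [map_add, germ_res, germ_res]
    exact add_mem hs ht
  smul_mem' := by
    rintro a _ ⟨U, hU, s, rfl, hs⟩
    exact ⟨U, hU, a • s, map_smul _ _ _, by rw [map_smul]; exact Submodule.smul_mem _ _ hs⟩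

/-- The subspace `G_{i_ξ(θ)}` of the stalk of `i_∞^* L` at `θ`, where `i_∞` is the circle of
radius `r`. -/
def subAt (r : Set.Ioi (0 : ℝ)) (S : SheafPair k) (ξ : ℂ) (w : S1.{u}) :
    Submodule k (Stalk ((pull k (circ r)).obj S.L) w) :=
  (transported r S ξ w).map (pullStalk (circ r) S.L w)

/-- `(L, G) ↦ (i_∞^* L, i_ξ^* G)`, where `i_∞` is the circle of radius `r`. -/
def disassemble (r : Set.Ioi (0 : ℝ)) (S : SheafPair k) : FilteredSheaf k where
  L := (pull k (circ r)).obj S.L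
  fil ξ := Subsheaf.ofStalks _ (subAt r S ξ)

/-- The circle of radius `r` around `0` encircles all the curves `S_c`, `c ∈ E`. -/
def Encircles (r : Set.Ioi (0 : ℝ)) (E : Finset ℂ) : Prop :=
  ∀ c ∈ E, ∀ w : S1.{u}, ‖(param c w).down.1‖ < r

/-- `τ` is restriction to the circles: it is given on objects by `(L, G) ↦ (i_∞^* L, i_ξ^* G)` with
`i_∞` the circle of radius `r (L, G)`, and on morphisms by restriction of `f`, the circles of
different radii being identified along the rays. (If `r X = r Y`, the second condition says that
`τ f` is `i_∞^* f`.) -/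
def IsCircleRestriction (r : SSh k → Set.Ioi (0 : ℝ)) (τ : SSh k ⥤ Sto k) : Prop :=
  ∃ e : ∀ X : SSh k, (τ.obj X).obj ≅ disassemble (r X) X.obj,
    ∀ {X Y : SSh k} (f : X ⟶ Y) (w : S1.{u}) (U : Opens Cstar.{u}) (hU : ray w ⊆ U)
      (s : Sec X.obj.L U),
      onStalk ((e X).inv ≫ (τ.map f).hom ≫ (e Y).hom).hom w
          (pullStalk (circ (r X)) X.obj.L w
            (germ X.obj.L U (circ (r X) w) (hU (circ_mem_ray _ w)) s)) =
        pullStalk (circ (r Y)) Y.obj.L w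
          (germ Y.obj.L U (circ (r Y) w) (hU (circ_mem_ray _ w)) (onSec f.hom.hom U s))

end Categories

end CoStokes

end

open CoStokes

/-! In polar coordinates `z = e^t w` on `ℂ*` the curve `S_ξ` is the graph `t = Re (ξ w⁻¹)`. Hence,
for `z ∈ S_ξ` over `w`, the relation `S_c < z` is the relation `c <_w ξ`, and it depends on `ξ` only
through `z`. Since every point of `ℂ*` lies on some `S_ξ`, the subspaces `L_{<ξ,w}` and the stalks
of `G` at the points `i_ξ(w)` are the same data. The translation is made with adapted frames: a
frame adapted to the filtration pulls back to one adapted to `G` (`IsStokesFrame.pull`), and a frame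
over a sector adapted to `G` restricts to one adapted to the filtration (`IsPairFrame.disassemble`).

`σ` is fully faithful because the rays are connected: `L → π_* π^* L` is an isomorphism for local
systems (`onStalk_unit_bijective`), and a morphism that respects `G` respects each `L_{<ξ}`, which
is `G` read along `S_ξ`.

For essential surjectivity, a local system on `ℂ*` is constant along the rays, so `L ≅ π^* i_∞^* L`.
Two difficulties remain. The decompositions adapted to `G` are not canonical and exist only near
points, whereas one is needed near a whole ray. They are glued upwards in `t`, at levels that avoid
the curves over `w`: there the pieces below the level span the stalk of `G` for both decompositions,
so these pieces can be taken from the lower one and the others from the upper one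
(`exists_splitting_near_line`). Then `gr_c` has to be defined on all of `S¹`. As only local
isomorphisms are required, constant sheaves of the right rank suffice; the rank is the dimension of
a graded piece in a generic direction (`IsStokesFrame.finrank_le`) and is constant because `S¹` is
connected. After this, `τ` and the equivalence are formal. -/

noncomputable section

namespace CoStokes

/-! ### Germs, inverse images, subsheaves and frames -/

section Basic

variable {k : Type u} [Field k] {X Y : TopCat.{u}}

lemma res_res (F : Sh k X) {U V W : Opens X} (h : V ≤ U) (h' : W ≤ V) (s : Sec F U) :
    res F h' (res F h s) = res F (h'.trans h) s := by
  have := F.presheaf.map_comp (homOfLE h).op (homOfLE h').op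
  exact (ConcreteCategory.congr_hom this s).symm

lemma pullSec_res (f : X ⟶ Y) (F : Sh k Y) {U V : Opens Y} (h : V ≤ U)
    (h' : (Opens.map f).obj V ≤ (Opens.map f).obj U) (s : Sec F U) :
    pullSec f F V (res F h s) = res ((pull k f).obj F) h' (pullSec f F U s) :=
  ConcreteCategory.congr_hom
    (((TopCat.Sheaf.pullbackPushforwardAdjunction (ModuleCat.{u} k) f).unit.app F).hom.naturality
      (homOfLE h).op) s

lemma sec_ext (F : Sh k X) {U : Opens X} {s t : Sec F U}
    (h : ∀ x (hx : x ∈ U), germ F U x hx s = germ F U x hx t) : s = t :=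
  TopCat.Presheaf.section_ext F U s t h

lemma exists_germ (F : Sh k X) (x : X) (a : Stalk F x) :
    ∃ (U : Opens X) (hx : x ∈ U) (s : Sec F U), germ F U x hx s = a :=
  TopCat.Presheaf.exists_germ_eq F.presheaf a

lemma exists_germ_le (F : Sh k X) {U : Opens X} {x : X} (hx : x ∈ U) (a : Stalk F x) :
    ∃ (V : Opens X) (_ : V ≤ U) (hx : x ∈ V) (s : Sec F V), germ F V x hx s = a := by
  obtain ⟨V, hV, s, rfl⟩ := exists_germ F x a
  exact ⟨U ⊓ V, inf_le_left, ⟨hx, hV⟩, res F inf_le_right s, germ_res _ _ _ _ _⟩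

lemma exists_res_eq (F : Sh k X) {U V : Opens X} {x : X} {hU : x ∈ U} {hV : x ∈ V}
    {s : Sec F U} {t : Sec F V} (h : germ F U x hU s = germ F V x hV t) :
    ∃ (W : Opens X) (hWU : W ≤ U) (hWV : W ≤ V), x ∈ W ∧ res F hWU s = res F hWV t := by
  obtain ⟨W, hW, iU, iV, e⟩ := TopCat.Presheaf.germ_eq F.presheaf x hU hV s t h
  exact ⟨W, iU.le, iV.le, hW, e⟩

lemma germ_eq_of_res_eq (F : Sh k X) {U V W : Opens X} {hWU : W ≤ U} {hWV : W ≤ V}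
    {s : Sec F U} {t : Sec F V} (h : res F hWU s = res F hWV t) (x : X) (hx : x ∈ W) :
    germ F U x (hWU hx) s = germ F V x (hWV hx) t := by
  rw [← germ_res F hWU x hx, h, germ_res]

lemma exists_section_of_germs (F : Sh k X) (U : Opens X) (b : ∀ x ∈ U, Stalk F x)
    (h : ∀ x ∈ U, ∃ (V : Opens X) (hV : V ≤ U) (_ : x ∈ V) (s : Sec F V),
      ∀ y (hy : y ∈ V), germ F V y hy s = b y (hV hy)) :
    ∃ s : Sec F U, ∀ x (hx : x ∈ U), germ F U x hx s = b x hx := by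
  choose V hV hxV s hs using h
  obtain ⟨t, ht, -⟩ := F.existsUnique_gluing' (fun x : U => V x x.2) U
    (fun x => homOfLE (hV x x.2))
    (fun x hx => Opens.mem_iSup.2 ⟨⟨x, hx⟩, hxV x hx⟩) (fun x => s x x.2) (by
      intro i j
      refine sec_ext F fun y hy => ?_
      change germ F _ y hy (res F inf_le_left (s i i.2)) =
        germ F _ y hy (res F inf_le_right (s j j.2))
      rw [germ_res, germ_res, hs, hs])
  refine ⟨t, fun x hx => ?_⟩
  rw [← germ_res F (hV x hx) x (hxV x hx)]
  refine Eq.trans (congrArg _ (ht ⟨x, hx⟩)) (hs x hx x (hxV x hx))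

lemma hom_ext_of_stalk {F F' : Sh k X} {f g : F ⟶ F'}
    (h : ∀ x a, onStalk f x a = onStalk g x a) : f = g := by
  apply Sheaf.hom_ext
  ext U s
  induction U using Opposite.rec with | op U =>
  change onSec f U s = onSec g U s
  refine sec_ext F' fun x hx => ?_
  rw [← onStalk_germ, ← onStalk_germ, h]

lemma isIso_of_onStalk_bijective {F F' : Sh k X} (f : F ⟶ F')
    (h : ∀ x, Function.Bijective (onStalk f x)) : IsIso f := by
  have : ∀ x : X, IsIso ((TopCat.Presheaf.stalkFunctor (ModuleCat.{u} k) x).map f.hom) :=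
    fun x => (ConcreteCategory.isIso_iff_bijective _).2 (h x)
  exact TopCat.Presheaf.isIso_of_stalkFunctor_map_iso f

lemma onStalk_comp {F F' F'' : Sh k X} (f : F ⟶ F') (g : F' ⟶ F'') (x : X) (a : Stalk F x) :
    onStalk (f ≫ g) x a = onStalk g x (onStalk f x a) := by
  obtain ⟨U, hU, s, rfl⟩ := exists_germ F x a
  simp only [onStalk_germ]
  rfl

lemma onStalk_id (F : Sh k X) (x : X) (a : Stalk F x) : onStalk (𝟙 F) x a = a := by
  obtain ⟨U, hU, s, rfl⟩ := exists_germ F x a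
  rw [onStalk_germ]
  rfl

lemma onStalk_inv_hom {F F' : Sh k X} (f : F ≅ F') (x : X) (a : Stalk F x) :
    onStalk f.inv x (onStalk f.hom x a) = a := by
  rw [← onStalk_comp, f.hom_inv_id, onStalk_id]

lemma onStalk_hom_inv {F F' : Sh k X} (f : F ≅ F') (x : X) (a : Stalk F' x) :
    onStalk f.hom x (onStalk f.inv x a) = a :=
  onStalk_inv_hom f.symm x a

/-- The inverse image is the sheafification of the presheaf inverse image, up to the unique
isomorphism `φ` between left adjoints, which matches the units. Neither the presheaf inverse image
nor sheafification changes the stalks. -/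
lemma pullStalk_bijective (f : X ⟶ Y) (F : Sh k Y) (x : X) :
    Function.Bijective (pullStalk f F x) := by
  let adj' := Functor.sheafPullbackConstruction.sheafAdjunctionContinuous (Opens.map f)
    (ModuleCat.{u} k) (Opens.grothendieckTopology Y) (Opens.grothendieckTopology X)
  let i := Functor.sheafPullbackConstruction.sheafPullbackIso (Opens.map f) (ModuleCat.{u} k)
    (Opens.grothendieckTopology Y) (Opens.grothendieckTopology X)
  let φ : (pull k f).obj F ≅ ((Functor.sheafPullbackConstruction.sheafPullback (Opens.map f)
    (ModuleCat.{u} k) (Opens.grothendieckTopology Y) (Opens.grothendieckTopology X)).obj F :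
      Sh k X) := i.app F
  let toS := toSheafify (Opens.grothendieckTopology X)
    ((TopCat.Presheaf.pullback (ModuleCat.{u} k) f).obj F.presheaf)
  have h : (TopCat.Sheaf.pullbackPushforwardAdjunction (ModuleCat.{u} k) f).unit.app F ≫
      (TopCat.Sheaf.pushforward _ f).map (i.hom.app F) = adj'.unit.app F :=
    Adjunction.unit_leftAdjointUniq_hom_app _ _ _
  have h3 (U : Opens Y) (s : Sec F U) : onSec φ.hom ((Opens.map f).obj U) (pullSec f F U s) =
      (toS.app (op ((Opens.map f).obj U))).hom
        ((((TopCat.Presheaf.pullbackPushforwardAdjunction (ModuleCat.{u} k) f).unit.app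
          F.presheaf).app (op U)).hom s) :=
    ConcreteCategory.congr_hom (congrArg (fun g => g.hom.app (op U)) h) s
  have b1 : Function.Bijective ((TopCat.Presheaf.stalkFunctor (ModuleCat.{u} k) x).map toS).hom :=
    @ConcreteCategory.bijective_of_isIso _ _ _ _ _ _ _ _ _
      (TopCat.Presheaf.stalkFunctor_map_unit_toSheafify_isIso _ _ _)
  have b2 : Function.Bijective
      (TopCat.Presheaf.stalkPullbackHom (ModuleCat.{u} k) f F.presheaf x).hom :=
    @ConcreteCategory.bijective_of_isIso _ _ _ _ _ _ _ _ _
      (TopCat.Presheaf.stalkPullbackIso (ModuleCat.{u} k) f F.presheaf x).isIso_hom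
  have b3 : Function.Bijective (onStalk φ.hom x) :=
    Function.bijective_iff_has_inverse.2 ⟨_, onStalk_inv_hom φ x, onStalk_hom_inv φ x⟩
  refine (Function.Bijective.of_comp_iff' b3 _).1 ?_
  have key : (onStalk φ.hom x ∘ pullStalk f F x) =
      ((TopCat.Presheaf.stalkFunctor (ModuleCat.{u} k) x).map toS).hom ∘
        (TopCat.Presheaf.stalkPullbackHom (ModuleCat.{u} k) f F.presheaf x).hom := by
    funext a
    obtain ⟨U, hU, s, rfl⟩ := exists_germ F (f x) a
    have hU' : x ∈ (Opens.map f).obj U := hU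
    have e1 : (TopCat.Presheaf.stalkPullbackHom (ModuleCat.{u} k) f F.presheaf x).hom
        (germ F U (f x) hU s) = _ := ConcreteCategory.congr_hom
      (TopCat.Presheaf.germ_stalkPullbackHom (ModuleCat.{u} k) f F.presheaf x U hU) s
    have e2 : onStalk φ.hom x (pullStalk f F x (germ F U (f x) hU s)) =
        germ _ _ x hU' (onSec φ.hom _ (pullSec f F U s)) :=
      (congrArg _ (pullStalk_germ f F x U hU hU' s)).trans (onStalk_germ φ.hom _ x hU' _)
    refine (e2.trans (congrArg _ (h3 U s))).trans (Eq.trans ?_ (congrArg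
      ((TopCat.Presheaf.stalkFunctor (ModuleCat.{u} k) x).map toS).hom e1).symm)
    exact (TopCat.Presheaf.stalkFunctor_map_germ_apply _ x hU' toS _).symm
  rw [key]
  exact b1.comp b2

namespace Subsheaf

variable {F : Sh k X}

lemma germ_mem_stalk (G : Subsheaf F) {U : Opens X} {s : Sec F U} (hs : s ∈ G.sec U) (x : X)
    (hx : x ∈ U) : germ F U x hx s ∈ G.stalk x :=
  ⟨U, hx, s, hs, rfl⟩

lemma mem_sec_iff (G : Subsheaf F) {U : Opens X} {s : Sec F U} :
    s ∈ G.sec U ↔ ∀ x (hx : x ∈ U), germ F U x hx s ∈ G.stalk x := by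
  refine ⟨fun h x hx => G.germ_mem_stalk h x hx, fun h => G.mem_of_locally s fun x hx => ?_⟩
  obtain ⟨V, hV, t, ht, e⟩ := h x hx
  obtain ⟨W, hWV, hWU, hW, e⟩ := exists_res_eq F e
  exact ⟨W, hWU, hW, e ▸ G.res_mem hWV ht⟩

/-- In general only an inclusion: a vector of `P x` need not extend to a section with values in `P`.
Equality is obtained from adapted frames in `isFrame_mem_stalk_ofStalks`. -/
lemma stalk_ofStalks_le (P : ∀ x, Submodule k (Stalk F x)) (x : X) :
    (ofStalks F P).stalk x ≤ P x := by
  rintro _ ⟨U, hU, s, hs, rfl⟩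
  exact hs x hU

end Subsheaf

lemma exists_opens_forall {ι : Type*} [Finite ι] {x : X} (P : ι → Opens X → Prop)
    (mono : ∀ i U V, V ≤ U → P i U → P i V) (h : ∀ i, ∃ U : Opens X, x ∈ U ∧ P i U) :
    ∃ U : Opens X, x ∈ U ∧ ∀ i, P i U := by
  cases nonempty_fintype ι
  choose U hU hP using h
  refine ⟨Finset.univ.inf U, ?_, fun i => mono i _ _ (Finset.inf_le (Finset.mem_univ i)) (hP i)⟩
  rw [← SetLike.mem_coe, Opens.coe_finset_inf]
  simpa using hU

/-- A family of sections over `U` indexed linearly by `M` that trivializes `F` on `U`. -/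
def IsFrame {F : Sh k X} {U : Opens X} {M : Type u} [AddCommGroup M] [Module k M]
    (σ : M →ₗ[k] Sec F U) : Prop :=
  ∀ x (hx : x ∈ U), Function.Bijective fun m => germ F U x hx (σ m)

namespace IsFrame

variable {F : Sh k X} {U : Opens X} {M : Type u} [AddCommGroup M] [Module k M]
  {σ : M →ₗ[k] Sec F U}

lemma res (h : IsFrame σ) {V : Opens X} (hV : V ≤ U) : IsFrame (CoStokes.res F hV ∘ₗ σ) := by
  intro x hx
  simp only [LinearMap.comp_apply, germ_res]
  exact h x (hV hx)

lemma comp (h : IsFrame σ) {N : Type u} [AddCommGroup N] [Module k N] (e : N ≃ₗ[k] M) :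
    IsFrame (σ ∘ₗ e.toLinearMap) :=
  fun x hx => (h x hx).comp e.bijective

/-- The isomorphism of `M` with the stalk given by a frame. -/
def stalkEquiv (h : IsFrame σ) (x : X) (hx : x ∈ U) : M ≃ₗ[k] Stalk F x :=
  LinearEquiv.ofBijective (germ F U x hx ∘ₗ σ) (h x hx)

lemma stalkEquiv_apply (h : IsFrame σ) (x : X) (hx : x ∈ U) (m : M) :
    h.stalkEquiv x hx m = germ F U x hx (σ m) := rfl

lemma germ_stalkEquiv_symm (h : IsFrame σ) (x : X) (hx : x ∈ U) (a : Stalk F x) :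
    germ F U x hx (σ ((h.stalkEquiv x hx).symm a)) = a :=
  (h.stalkEquiv x hx).apply_symm_apply a

lemma exists_eq (h : IsFrame σ) (x : X) (hx : x ∈ U) (a : Stalk F x) :
    ∃ m, germ F U x hx (σ m) = a := (h x hx).2 a

/-- The function with values in `M` that corresponds to a section. -/
def coord (h : IsFrame σ) {V : Opens X} (hV : V ≤ U) (s : Sec F V) (x : V) : M :=
  (h.stalkEquiv x.1 (hV x.2)).symm (germ F V x.1 x.2 s)

lemma coord_eq_iff (h : IsFrame σ) {V : Opens X} (hV : V ≤ U) (s : Sec F V) (x : V) (m : M) :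
    h.coord hV s x = m ↔ germ F V x.1 x.2 s = germ F U x.1 (hV x.2) (σ m) := by
  rw [coord, LinearEquiv.symm_apply_eq, stalkEquiv_apply]

lemma germ_coord (h : IsFrame σ) {V : Opens X} (hV : V ≤ U) (s : Sec F V) (x : V) :
    germ F U x.1 (hV x.2) (σ (h.coord hV s x)) = germ F V x.1 x.2 s :=
  ((h.coord_eq_iff hV s x _).1 rfl).symm

lemma isLocallyConstant_coord (h : IsFrame σ) {V : Opens X} (hV : V ≤ U) (s : Sec F V) :
    IsLocallyConstant (h.coord hV s) := by
  rw [IsLocallyConstant.iff_exists_open]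
  intro x
  obtain ⟨W, hW, hWU, hxW, e⟩ := exists_res_eq F (h.germ_coord hV s x).symm
  refine ⟨Subtype.val ⁻¹' W, W.2.preimage continuous_subtype_val, hxW, fun y hy => ?_⟩
  rw [coord_eq_iff]
  exact germ_eq_of_res_eq F e y.1 hy

/-- Over the domain of a frame, sections are locally constant functions. -/
def secEquiv (h : IsFrame σ) (V : Opens X) (hV : V ≤ U) : Sec F V ≃ₗ[k] LocallyConstant V M :=
  LinearEquiv.ofBijective
    { toFun := fun s => ⟨h.coord hV s, h.isLocallyConstant_coord hV s⟩
      map_add' := fun s t => by ext x; simp [coord]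
      map_smul' := fun a s => by ext x; simp [coord] }
    (by
      constructor
      · intro s t e
        refine sec_ext F fun x hx => ?_
        have := DFunLike.congr_fun e ⟨x, hx⟩
        change h.coord hV s ⟨x, hx⟩ = h.coord hV t ⟨x, hx⟩ at this
        rw [← h.germ_coord hV s ⟨x, hx⟩, this, h.germ_coord hV t ⟨x, hx⟩]
      · intro f
        obtain ⟨s, hs⟩ := exists_section_of_germs F V
          (fun x hx => germ F U x (hV hx) (σ (f ⟨x, hx⟩))) (by
            intro x hx
            obtain ⟨O, hO, hxO, e⟩ := (IsLocallyConstant.iff_exists_open _).1 f.2 ⟨x, hx⟩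
            obtain ⟨O', hO', rfl⟩ := isOpen_induced_iff.1 hO
            refine ⟨V ⊓ ⟨O', hO'⟩, inf_le_left, ⟨hx, hxO⟩,
              CoStokes.res F (inf_le_left.trans hV) (σ (f ⟨x, hx⟩)), fun y hy => ?_⟩
            rw [germ_res]
            have : f ⟨y, hy.1⟩ = f ⟨x, hx⟩ := e ⟨y, hy.1⟩ hy.2
            rw [this])
        refine ⟨s, LocallyConstant.ext fun x => ?_⟩
        exact (h.coord_eq_iff hV s x _).2 (hs x.1 x.2))

lemma secEquiv_apply (h : IsFrame σ) (V : Opens X) (hV : V ≤ U) (s : Sec F V) (x : V) :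
    h.secEquiv V hV s x = h.coord hV s x := rfl

lemma secEquiv_eq_iff (h : IsFrame σ) {V : Opens X} (hV : V ≤ U) (s : Sec F V) (x : V) (m : M) :
    h.secEquiv V hV s x = m ↔ germ F V x.1 x.2 s = germ F U x.1 (hV x.2) (σ m) :=
  h.coord_eq_iff hV s x m

lemma secEquiv_res (h : IsFrame σ) {V W : Opens X} (hV : V ≤ U) (hW : W ≤ V) (s : Sec F V)
    (x : W) :
    h.secEquiv W (hW.trans hV) (CoStokes.res F hW s) x = h.secEquiv V hV s ⟨x.1, hW x.2⟩ := by
  rw [secEquiv_apply, secEquiv_apply, coord, coord, germ_res]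

/-- A frame identifies `F` with a constant sheaf. -/
def constantOn (h : IsFrame σ) : ConstantOn F U (ModuleCat.of k M) where
  equiv := h.secEquiv
  equiv_res hV hW s x := h.secEquiv_res hV hW s x

lemma finite (h : IsFrame σ) [Module.Finite k M] (x : X) (hx : x ∈ U) :
    Module.Finite k (Stalk F x) :=
  Module.Finite.equiv (h.stalkEquiv x hx)

end IsFrame

/-- Constant functions form a frame of a constant sheaf. -/
def ConstantOn.frame {F : Sh k X} {U : Opens X} {M : ModuleCat.{u} k} (h : ConstantOn F U M) :
    M →ₗ[k] Sec F U :=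
  (h.equiv U le_rfl).symm.toLinearMap ∘ₗ
    { toFun := LocallyConstant.const U
      map_add' := fun _ _ => rfl
      map_smul' := fun _ _ => rfl }

lemma ConstantOn.equiv_frame {F : Sh k X} {U : Opens X} {M : ModuleCat.{u} k}
    (h : ConstantOn F U M) (m : M) (V : Opens X) (hV : V ≤ U) (x : V) :
    h.equiv V hV (res F hV (h.frame m)) x = m := by
  rw [h.equiv_res le_rfl hV]
  simp only [ConstantOn.frame, LinearMap.comp_apply, LinearEquiv.coe_coe,
    LinearEquiv.apply_symm_apply]
  rfl

lemma ConstantOn.isFrame {F : Sh k X} {U : Opens X} {M : ModuleCat.{u} k}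
    (h : ConstantOn F U M) : IsFrame h.frame := by
  intro x hx
  constructor
  · intro m n e
    obtain ⟨W, hW, hW', hxW, e'⟩ := exists_res_eq F e
    rw [← h.equiv_frame m W hW ⟨x, hxW⟩, e', h.equiv_frame]
  · intro a
    obtain ⟨V, hV, hxV, s, rfl⟩ := exists_germ_le F hx a
    refine ⟨h.equiv V hV s ⟨x, hxV⟩, ?_⟩
    obtain ⟨O, hO, hxO, e⟩ := (IsLocallyConstant.iff_exists_open _).1 (h.equiv V hV s).2 ⟨x, hxV⟩
    obtain ⟨O', hO', rfl⟩ := isOpen_induced_iff.1 hO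
    have hx' : x ∈ V ⊓ ⟨O', hO'⟩ := ⟨hxV, hxO⟩
    refine germ_eq_of_res_eq F (W := V ⊓ ⟨O', hO'⟩) (hWU := inf_le_left.trans hV)
      (hWV := inf_le_left) ?_ x hx'
    refine (h.equiv _ (inf_le_left.trans hV)).injective (LocallyConstant.ext fun y => ?_)
    rw [h.equiv_frame, h.equiv_res hV]
    exact (e ⟨y.1, y.2.1⟩ y.2.2).symm

lemma IsLocalSystem.exists_frame {F : Sh k X} (hF : IsLocalSystem F) (x : X) :
    ∃ U : Opens X, x ∈ U ∧ ∃ (M : ModuleCat.{u} k) (σ : M →ₗ[k] Sec F U),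
      Module.Finite k M ∧ IsFrame σ := by
  obtain ⟨U, hU, M, hM, ⟨h⟩⟩ := hF x
  exact ⟨U, hU, M, h.frame, hM, h.isFrame⟩

lemma IsLocalSystem.of_frame {F : Sh k X} (h : ∀ x, ∃ U : Opens X, x ∈ U ∧
    ∃ (M : ModuleCat.{u} k) (σ : M →ₗ[k] Sec F U), Module.Finite k M ∧ IsFrame σ) :
    IsLocalSystem F := by
  intro x
  obtain ⟨U, hU, M, σ, hM, h⟩ := h x
  exact ⟨U, hU, M, hM, ⟨h.constantOn⟩⟩

/-- Two germs agree on an open set for any sheaf. For a local system they also differ on an open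
set, because near a point both sections are constant with respect to a frame. Connectedness excludes
having both. -/
lemma IsLocalSystem.germ_eq_of_isPreconnected {F : Sh k X} (hF : IsLocalSystem F) {C : Set X}
    (hC : IsPreconnected C) {U V : Opens X} (hU : C ⊆ U) (hV : C ⊆ V) {s : Sec F U} {t : Sec F V}
    {x : X} (hx : x ∈ C) (h : germ F U x (hU hx) s = germ F V x (hV hx) t) {y : X} (hy : y ∈ C) :
    germ F U y (hU hy) s = germ F V y (hV hy) t := by
  let A : Set X := {z | ∃ (hz : z ∈ U) (hz' : z ∈ V), germ F U z hz s = germ F V z hz' t}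
  let B : Set X := {z | ∃ (hz : z ∈ U) (hz' : z ∈ V), germ F U z hz s ≠ germ F V z hz' t}
  have hA : IsOpen A := by
    rw [isOpen_iff_forall_mem_open]
    rintro z ⟨hz, hz', e⟩
    obtain ⟨W, hWU, hWV, hzW, e⟩ := exists_res_eq F e
    exact ⟨W, fun v hv => ⟨hWU hv, hWV hv, germ_eq_of_res_eq F e v hv⟩, W.2, hzW⟩
  have hB : IsOpen B := by
    rw [isOpen_iff_forall_mem_open]
    rintro z ⟨hz, hz', e⟩
    obtain ⟨O, hO, M, σ, -, hσ⟩ := hF.exists_frame z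
    obtain ⟨m, hm⟩ := hσ.exists_eq z hO (germ F U z hz s)
    obtain ⟨n, hn⟩ := hσ.exists_eq z hO (germ F V z hz' t)
    obtain ⟨W, hWO, hWU, hzW, em⟩ := exists_res_eq F hm
    obtain ⟨W', hWO', hWV, hzW', en⟩ := exists_res_eq F hn
    refine ⟨W ∩ W', fun v hv => ⟨hWU hv.1, hWV hv.2, ?_⟩, W.2.inter W'.2, hzW, hzW'⟩
    rw [← germ_eq_of_res_eq F em v hv.1, ← germ_eq_of_res_eq F en v hv.2]
    intro e'
    have : m = n := (hσ v (hWO hv.1)).1 e'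
    subst this
    exact e (hm.symm.trans hn)
  by_contra hne
  obtain ⟨z, -, ⟨h1, h2, h3⟩, ⟨h4, h5, h6⟩⟩ := hC A B hA hB
    (fun z hz => by
      by_cases e : germ F U z (hU hz) s = germ F V z (hV hz) t
      · exact Or.inl ⟨_, _, e⟩
      · exact Or.inr ⟨_, _, e⟩) ⟨x, hx, _, _, h⟩ ⟨y, hy, _, _, hne⟩
  exact h6 h3

lemma IsFrame.pull {F : Sh k Y} {U : Opens Y} {M : Type u} [AddCommGroup M] [Module k M]
    {σ : M →ₗ[k] Sec F U} (h : IsFrame σ) (f : X ⟶ Y) : IsFrame (pullSec f F U ∘ₗ σ) := by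
  intro x hx
  have : (fun m => germ ((CoStokes.pull k f).obj F) ((Opens.map f).obj U) x hx
      ((pullSec f F U ∘ₗ σ) m)) =
      pullStalk f F x ∘ fun m => germ F U (f x) hx (σ m) := by
    funext m
    exact (pullStalk_germ f F x U hx hx (σ m)).symm
  rw [this]
  exact (pullStalk_bijective f F x).comp (h (f x) hx)

lemma IsLocalSystem.pull {F : Sh k Y} (hF : IsLocalSystem F) (f : X ⟶ Y) :
    IsLocalSystem ((CoStokes.pull k f).obj F) := by
  refine .of_frame fun x => ?_
  obtain ⟨U, hU, M, σ, hM, hσ⟩ := hF.exists_frame (f x)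
  exact ⟨_, hU, M, _, hM, hσ.pull f⟩

end Basic

/-! ### Polar coordinates, the curves `S_ξ` and sectors -/

section Polar

/-- Polar coordinates: the point `e^t w`. -/
def polar (w : S1.{u}) (t : ℝ) : Cstar.{u} :=
  ⟨⟨(Real.exp t : ℝ) * (w.down : ℂ), by simp [-Complex.ofReal_exp, Real.exp_ne_zero]⟩⟩

/-- The logarithm of the modulus. -/
def logNorm (z : Cstar.{u}) : ℝ := Real.log ‖z.down.1‖

lemma proj_polar (w : S1.{u}) (t : ℝ) : proj (polar w t) = w :=
  proj_real_mul _ (Real.exp_pos t) w _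

lemma norm_polar (w : S1.{u}) (t : ℝ) : ‖(polar w t).down.1‖ = Real.exp t := by
  change ‖((Real.exp t : ℝ) : ℂ) * (w.down : ℂ)‖ = _
  rw [norm_mul, Circle.norm_coe, mul_one, Complex.norm_real, Real.norm_of_nonneg (Real.exp_pos t).le]

lemma logNorm_polar (w : S1.{u}) (t : ℝ) : logNorm (polar w t) = t := by
  rw [logNorm, norm_polar, Real.log_exp]

lemma norm_pos (z : Cstar.{u}) : 0 < ‖z.down.1‖ := norm_pos_iff.2 z.down.2

lemma polar_proj_logNorm (z : Cstar.{u}) : polar (proj z) (logNorm z) = z := by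
  apply ULift.ext
  apply Subtype.ext
  change ((Real.exp (Real.log ‖z.down.1‖) : ℝ) : ℂ) * (z.down.1 / (‖z.down.1‖ : ℝ)) = z.down.1
  have h : ((‖z.down.1‖ : ℝ) : ℂ) ≠ 0 := by exact_mod_cast (norm_pos z).ne'
  rw [Real.exp_log (norm_pos z)]
  field_simp

lemma exists_polar (z : Cstar.{u}) : ∃ w t, polar w t = z := ⟨_, _, polar_proj_logNorm z⟩

lemma continuous_polar : Continuous fun p : S1.{u} × ℝ => polar p.1 p.2 := by
  refine continuous_uliftUp.comp (Continuous.subtype_mk ?_ _)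
  refine (Complex.continuous_ofReal.comp (Real.continuous_exp.comp continuous_snd)).mul ?_
  exact continuous_subtype_val.comp (continuous_uliftDown.comp continuous_fst)

lemma continuous_logNorm : Continuous logNorm.{u} := by
  refine Continuous.log ?_ fun z => (norm_pos z).ne'
  exact (continuous_subtype_val.comp continuous_uliftDown).norm

lemma continuous_proj : Continuous (proj.{u} : Cstar.{u} → S1.{u}) := proj.hom.continuous

/-- Polar coordinates as a homeomorphism. -/
def polarHomeomorph : S1.{u} × ℝ ≃ₜ Cstar.{u} where
  toFun p := polar p.1 p.2
  invFun z := (proj z, logNorm z)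
  left_inv _ := Prod.ext (proj_polar _ _) (logNorm_polar _ _)
  right_inv z := polar_proj_logNorm z
  continuous_toFun := continuous_polar
  continuous_invFun := continuous_proj.prodMk continuous_logNorm

lemma outside_polar (c : ℂ) (w : S1.{u}) (t : ℝ) :
    Outside c (polar w t) ↔ (c * (w.down : ℂ)⁻¹).re < t := by
  rw [Outside, proj_polar, norm_polar, Real.exp_lt_exp]

lemma polar_mem_curve (c : ℂ) (w : S1.{u}) (t : ℝ) :
    polar w t ∈ curve.{u} c ↔ (c * (w.down : ℂ)⁻¹).re = t := by
  change ‖(polar w t).down.1‖ = _ ↔ _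
  rw [proj_polar, norm_polar, Real.exp_eq_exp, eq_comm]

lemma param_eq_polar (ξ : ℂ) (w : S1.{u}) : param ξ w = polar w (ξ * (w.down : ℂ)⁻¹).re := rfl

lemma param_mem_curve (ξ : ℂ) (w : S1.{u}) : param ξ w ∈ curve.{u} ξ :=
  (polar_mem_curve _ _ _).2 rfl

lemma eq_param_of_mem_curve {ξ : ℂ} {z : Cstar.{u}} (hz : z ∈ curve.{u} ξ) :
    z = param ξ (proj z) := by
  obtain ⟨w, t, rfl⟩ := exists_polar z
  rw [proj_polar, param_eq_polar, (polar_mem_curve _ _ _).1 hz]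

lemma proj_param (ξ : ℂ) (w : S1.{u}) : proj (param ξ w) = w := proj_polar _ _

lemma proj_circ (r : Set.Ioi (0 : ℝ)) (w : S1.{u}) : proj (circ r w) = w := circ_mem_ray r w

/-- Both sides compare `Re (c e^{-iθ})` with `log |z|`, which equals `Re (ξ e^{-iθ})` on `S_ξ`. This
is the dictionary between filtrations on `S¹` and subsheaves on `ℂ*`. -/
lemma outside_iff_of_mem_curve {ξ c : ℂ} {z : Cstar.{u}} (hz : z ∈ curve.{u} ξ) :
    Outside c z ↔ LtAt (proj z) c ξ := by
  obtain ⟨w, t, rfl⟩ := exists_polar z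
  rw [outside_polar, proj_polar, LtAt, (polar_mem_curve _ _ _).1 hz]

/-- Ensures that the intersection defining `G` at `z` is never empty. The witness is `ξ = log |z| ·
e^{iθ}`. -/
lemma exists_mem_curve (z : Cstar.{u}) : ∃ ξ : ℂ, z ∈ curve.{u} ξ := by
  obtain ⟨w, t, rfl⟩ := exists_polar z
  refine ⟨t * w.down, (polar_mem_curve _ _ _).2 ?_⟩
  have : (w.down : ℂ) ≠ 0 := Circle.coe_ne_zero _
  rw [mul_inv_cancel_right₀ this, Complex.ofReal_re]

lemma continuous_re_mul_inv (c : ℂ) :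
    Continuous fun w : S1.{u} => (c * (w.down : ℂ)⁻¹).re := by
  refine Complex.continuous_re.comp (continuous_const.mul ?_)
  exact (continuous_subtype_val.comp continuous_uliftDown).inv₀ fun w => Circle.coe_ne_zero _

lemma isOpen_ltAt (c ξ : ℂ) : IsOpen {w : S1.{u} | LtAt w c ξ} :=
  isOpen_lt (continuous_re_mul_inv c) (continuous_re_mul_inv ξ)

lemma isOpen_outside (c : ℂ) : IsOpen {z : Cstar.{u} | Outside c z} :=
  isOpen_lt (Real.continuous_exp.comp ((continuous_re_mul_inv c).comp continuous_proj))
    (continuous_subtype_val.comp continuous_uliftDown).norm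

/-- The union of the rays through the points of `W`. -/
abbrev sector (W : Opens S1.{u}) : Opens Cstar.{u} := (Opens.map proj).obj W

lemma sector_mono {U V : Opens S1.{u}} (h : V ≤ U) : sector V ≤ sector U := fun _ hz => h hz

lemma polar_mem_sector {U : Opens S1.{u}} {w : S1.{u}} (hw : w ∈ U) (t : ℝ) :
    polar w t ∈ sector U := by
  change proj (polar w t) ∈ U
  rwa [proj_polar]

lemma ray_subset_sector {U : Opens S1.{u}} {w : S1.{u}} (hw : w ∈ U) :
    ray w ⊆ (sector U : Set Cstar.{u}) := by
  rintro z rfl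
  exact hw

lemma isPreconnected_sector {W : Opens S1.{u}} (hW : IsPreconnected (W : Set S1.{u})) :
    IsPreconnected (sector W : Set Cstar.{u}) := by
  have : (sector W : Set Cstar.{u}) = polarHomeomorph '' ((W : Set S1.{u}) ×ˢ Set.univ) := by
    ext z
    constructor
    · exact fun hz => ⟨(proj z, logNorm z), ⟨hz, trivial⟩, polar_proj_logNorm z⟩
    · rintro ⟨⟨w, t⟩, ⟨hw, -⟩, rfl⟩
      change proj (polar w t) ∈ W
      rwa [proj_polar]
  rw [this]
  exact (hW.prod isPreconnected_univ).image _ polarHomeomorph.continuous.continuousOn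

lemma isPreconnected_ray (w : S1.{u}) : IsPreconnected (ray w) := by
  have : ray w = (fun t => polar w t) '' Set.univ := by
    ext z
    constructor
    · rintro rfl
      exact ⟨logNorm z, trivial, polar_proj_logNorm z⟩
    · rintro ⟨t, -, rfl⟩
      exact proj_polar w t
  rw [this]
  exact isPreconnected_univ.image _
    (continuous_polar.comp (continuous_const.prodMk continuous_id)).continuousOn

instance : LocallyPathConnectedSpace Circle :=
  (Circle.isCoveringMap_exp.isQuotientMap Circle.exp_surjective).locallyPathConnectedSpace

instance : LocallyConnectedSpace S1.{u} :=
  (Homeomorph.ulift.{u} (X := Circle)).isOpenEmbedding.locallyConnectedSpace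

instance : LocallyConnectedSpace Cstar.{u} :=
  have : LocallyConnectedSpace {z : ℂ // z ≠ 0} :=
    (isOpen_compl_singleton (x := (0 : ℂ))).isOpenEmbedding_subtypeVal.locallyConnectedSpace
  (Homeomorph.ulift.{u} (X := {z : ℂ // z ≠ 0})).isOpenEmbedding.locallyConnectedSpace

lemma exists_preconnected_opens {X : TopCat.{u}} [LocallyConnectedSpace X] {U : Opens X} {x : X}
    (hx : x ∈ U) : ∃ V : Opens X, V ≤ U ∧ x ∈ V ∧ IsPreconnected (V : Set X) := by
  obtain ⟨V, hV, hVo, hxV, hVc⟩ :=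
    (locallyConnectedSpace_iff_subsets_isOpen_isConnected.1 ‹_›) x U (U.2.mem_nhds hx)
  exact ⟨⟨V, hVo⟩, hV, hxV, hVc.isPreconnected⟩

end Polar

/-! ### Local systems on `ℂ*` are constant along rays -/

section Lifting

variable {k : Type u} [Field k] {X : TopCat.{u}}

/-- Over a connected open set in the domain of a frame, each germ extends to exactly one section, so
the étale space is evenly covered there. -/
lemma IsLocalSystem.isCoveringMap [LocallyConnectedSpace X] {F : Sh k X} (hF : IsLocalSystem F) :
    IsCoveringMap (TopCat.Presheaf.EtaleSpace.base (F := F.presheaf)) := by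
  refine TopCat.Presheaf.EtaleSpace.isCoveringMap_base fun x => ?_
  obtain ⟨U, hU, M, σ, -, hσ⟩ := hF.exists_frame x
  obtain ⟨V, hV, hxV, hVc⟩ := exists_preconnected_opens hU
  refine ⟨V, hxV, fun y hy => ⟨fun s t e => ?_, fun a => ?_⟩⟩
  · exact sec_ext F fun z hz =>
      hF.germ_eq_of_isPreconnected hVc (le_refl _) (le_refl _) hy e hz
  · obtain ⟨m, hm⟩ := (hσ.res hV).exists_eq y hy a
    exact ⟨_, hm⟩

/-- Germs of a local system extend along simply connected spaces. -/
lemma IsLocalSystem.exists_section [LocallyConnectedSpace X] {F : Sh k X} (hF : IsLocalSystem F)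
    {A : Type*} [TopologicalSpace A] [SimplyConnectedSpace A] [LocallyPathConnectedSpace A]
    (f : C(A, X)) {U : Opens X} (ρ : C(U, A)) (hρ : ∀ x : U, f (ρ x) = x) (x : X) (hx : x ∈ U)
    (a : Stalk F x) : ∃ s : Sec F U, germ F U x hx s = a := by
  -- Lift `f` to the étale space through the germ `a`. Then `g ∘ ρ` is a continuous choice of germs
  -- over `U`, that is, a section.
  obtain ⟨g, ⟨hg0, hg⟩, -⟩ := hF.isCoveringMap.existsUnique_continuousMap_lifts f (ρ ⟨x, hx⟩)
    ⟨x, a⟩ (hρ ⟨x, hx⟩).symm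
  have hb : ∀ y (hy : y ∈ U), ∃ b : Stalk F y, g (ρ ⟨y, hy⟩) = ⟨y, b⟩ := by
    intro y hy
    have h : (g (ρ ⟨y, hy⟩)).base = y := (congrFun hg _).trans (hρ ⟨y, hy⟩)
    generalize g (ρ ⟨y, hy⟩) = e at h
    subst h
    exact ⟨e.germ, rfl⟩
  choose b hb using hb
  obtain ⟨s, hs⟩ := exists_section_of_germs F U b (by
    intro y hy
    have ht : Filter.Tendsto (fun z : U => g (ρ z)) (nhds ⟨y, hy⟩) (nhds (g (ρ ⟨y, hy⟩))) :=
      (g.continuous.comp ρ.continuous).tendsto _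
    obtain ⟨V, hV, t, ht⟩ := TopCat.Presheaf.EtaleSpace.exists_section_of_tendsto ht
    obtain ⟨O, hO, hOo, hyO⟩ := eventually_nhds_iff.1 ht
    obtain ⟨O', hO', rfl⟩ := isOpen_induced_iff.1 hOo
    have key : ∀ z (hzU : z ∈ U), z ∈ O' → ∃ hz : z ∈ V, b z hzU = germ F V z hz t := by
      intro z hzU hz
      have := hO ⟨z, hzU⟩ hz
      rw [hb z hzU] at this
      exact this
    refine ⟨U ⊓ ⟨O', hO'⟩, inf_le_left, ⟨hy, hyO⟩, res F (V := U ⊓ ⟨O', hO'⟩) (U := V)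
      (fun z hz => (key z hz.1 hz.2).1) t, fun z hz => ?_⟩
    rw [germ_res]
    exact (key z hz.1 hz.2).2.symm)
  refine ⟨s, (hs x hx).trans ?_⟩
  have := (hb x hx).symm.trans hg0
  simpa using this

/-- The arc of the points of `S¹` that are not antipodal to `w`. -/
def arc (w : S1.{u}) : Opens S1.{u} :=
  ⟨{v | ((v.down / w.down : Circle) : ℂ) ∈ Complex.slitPlane},
    Complex.isOpen_slitPlane.preimage
      (continuous_subtype_val.comp (continuous_uliftDown.div_const w.down))⟩

lemma mem_arc (w : S1.{u}) : w ∈ arc w := by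
  change ((w.down / w.down : Circle) : ℂ) ∈ Complex.slitPlane
  simp

lemma polar_exp_arg (w v : S1.{u}) :
    (⟨w.down * Circle.exp ((v.down / w.down : Circle) : ℂ).arg⟩ : S1.{u}) = v := by
  apply ULift.ext
  change w.down * Circle.exp ((v.down / w.down : Circle) : ℂ).arg = v.down
  rw [Circle.exp_arg]
  simp

/-- The universal covering `(θ, t) ↦ e^{t + iθ} w` of `ℂ*`. -/
def expMap (w : S1.{u}) : C(ℝ × ℝ, Cstar.{u}) where
  toFun p := polar ⟨w.down * Circle.exp p.1⟩ p.2
  continuous_toFun := continuous_polar.comp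
    ((continuous_uliftUp.comp
      (continuous_const.mul (Circle.exp.continuous.comp continuous_fst))).prodMk continuous_snd)

/-- A branch of the logarithm on the sector over `arc w`. -/
def logMap (w : S1.{u}) : C(sector (arc w), ℝ × ℝ) where
  toFun z := ((((proj z.1).down / w.down : Circle) : ℂ).arg, logNorm z.1)
  continuous_toFun := by
    refine Continuous.prodMk ?_ (continuous_logNorm.comp continuous_subtype_val)
    rw [continuous_iff_continuousAt]
    intro z
    refine ContinuousAt.comp (f := fun z : sector (arc w) =>
      (((proj z.1).down / w.down : Circle) : ℂ)) (Complex.continuousAt_arg z.2) ?_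
    exact (continuous_subtype_val.comp ((continuous_uliftDown.comp
      (continuous_proj.comp continuous_subtype_val)).div_const w.down)).continuousAt

lemma expMap_logMap (w : S1.{u}) (z : sector (arc w)) : expMap w (logMap w z) = z := by
  change polar ⟨w.down * Circle.exp (((proj z.1).down / w.down : Circle) : ℂ).arg⟩ _ = _
  rw [polar_exp_arg]
  exact polar_proj_logNorm _

/-- Local systems on `ℂ*` are constant along the rays. -/
lemma IsLocalSystem.exists_sector_frame {F : Sh k Cstar.{u}} (hF : IsLocalSystem F) (w : S1.{u}) :
    ∃ W : Opens S1.{u}, w ∈ W ∧ ∃ (M : ModuleCat.{u} k) (σ : M →ₗ[k] Sec F (sector W)),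
      Module.Finite k M ∧ IsFrame σ := by
  obtain ⟨W, hW, hwW, hWc⟩ := exists_preconnected_opens (mem_arc w)
  have hle : sector W ≤ sector (arc w) := sector_mono hW
  -- The sector over a connected arc is connected, whence injectivity. On it there is a branch of
  -- the logarithm, so germs extend by lifting along the universal covering `expMap w`, whence
  -- surjectivity. Thus any one stalk trivializes `F` on the sector.
  have hbij : ∀ x (hx : x ∈ sector W), Function.Bijective (germ F (sector W) x hx) := by
    refine fun x hx => ⟨fun s t e => ?_, fun a => ?_⟩
    · exact sec_ext F fun z hz => hF.germ_eq_of_isPreconnected (isPreconnected_sector hWc)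
        (le_refl _) (le_refl _) hx e hz
    · obtain ⟨s, rfl⟩ := hF.exists_section (expMap w) (logMap w) (expMap_logMap w) x (hle hx) a
      exact ⟨res F hle s, germ_res _ _ _ _ _⟩
  have hz : polar w 0 ∈ sector W := polar_mem_sector hwW 0
  obtain ⟨U, hU, M, τ, hM, hτ⟩ := hF.exists_frame (polar w 0)
  let e := LinearEquiv.ofBijective _ (hbij _ hz)
  refine ⟨W, hwW, Stalk F (polar w 0), e.symm.toLinearMap, hτ.finite _ hU, fun x hx => ?_⟩
  exact (hbij x hx).comp e.symm.bijective

end Lifting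

/-! ### Frames adapted to filtrations and to subsheaves -/

section Frames

variable {k : Type u} [Field k] {X Y : TopCat.{u}}

/-- Locally constant functions with values in a finite product. -/
def locallyConstantPiEquiv {T : Type*} [TopologicalSpace T] {ι : Type*} [Finite ι]
    (M : ι → ModuleCat.{u} k) :
    LocallyConstant T (∀ i, M i) ≃ₗ[k] ∀ i, LocallyConstant T (M i) where
  toFun f i := f.map fun m => m i
  map_add' _ _ := rfl
  map_smul' _ _ := rfl
  invFun g := ⟨fun t i => g i t, by
    rw [IsLocallyConstant.iff_eventually_eq]
    intro t
    have := Filter.eventually_all.2 fun i =>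
      (IsLocallyConstant.iff_eventually_eq _).1 (g i).isLocallyConstant t
    filter_upwards [this] with s hs
    exact funext hs⟩
  left_inv _ := rfl
  right_inv _ := rfl

/-- When the subspaces are given in a frame by the vanishing of the coordinates outside open sets `A
i`, a vector admissible at `x` remains admissible nearby: a coordinate that is allowed at `x` is
allowed on the neighbourhood `A i`, and the others are zero. So the prescribed subspaces are the
stalks. -/
lemma isFrame_mem_stalk_ofStalks {F : Sh k X} {U : Opens X} {ι : Type*} [Finite ι]
    {M : ι → ModuleCat.{u} k} {σ : (∀ i, M i) →ₗ[k] Sec F U}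
    {P : ∀ x, Submodule k (Stalk F x)} {A : ι → Set X} (hA : ∀ i, IsOpen (A i))
    (hP : ∀ x (hx : x ∈ U) m, germ F U x hx (σ m) ∈ P x ↔ ∀ i, x ∉ A i → m i = 0)
    (x : X) (hx : x ∈ U) (m : ∀ i, M i) :
    germ F U x hx (σ m) ∈ (Subsheaf.ofStalks F P).stalk x ↔ ∀ i, x ∉ A i → m i = 0 := by
  refine ⟨fun h => (hP x hx m).1 (Subsheaf.stalk_ofStalks_le P x h), fun h => ?_⟩
  obtain ⟨V, hxV, hV⟩ := exists_opens_forall (x := x)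
    (fun i (V : Opens X) => ∀ y ∈ V, y ∉ A i → m i = 0)
    (fun i V W hWV h y hy => h y (hWV hy)) (fun i => by
      by_cases hi : x ∈ A i
      · exact ⟨⟨A i, hA i⟩, hi, fun y hy hy' => (hy' hy).elim⟩
      · exact ⟨⊤, trivial, fun _ _ _ => h i hi⟩)
  refine ⟨U ⊓ V, ⟨hx, hxV⟩, res F inf_le_left (σ m), fun y hy => ?_, germ_res _ _ _ _ _⟩
  rw [germ_res]
  exact (hP y hy.1 m).2 fun i => hV i y hy.2

/-- A frame of `S.L` over `U` that is adapted to the filtration. -/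
structure IsStokesFrame (S : FilteredSheaf k) {E : Finset ℂ} {M : E → ModuleCat.{u} k}
    {U : Opens S1.{u}} (σ : (∀ c, M c) →ₗ[k] Sec S.L U) : Prop where
  isFrame : IsFrame σ
  mem_iff : ∀ w (hw : w ∈ U) (ξ : ℂ) (m : ∀ c, M c),
    germ S.L U w hw (σ m) ∈ (S.fil ξ).stalk w ↔ ∀ c : E, ¬ LtAt w c ξ → m c = 0

/-- A frame of `S.L` over `U` that is adapted to the subsheaf. -/
structure IsPairFrame (S : SheafPair k) {E : Finset ℂ} {M : E → ModuleCat.{u} k}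
    {U : Opens Cstar.{u}} (σ : (∀ c, M c) →ₗ[k] Sec S.L U) : Prop where
  isFrame : IsFrame σ
  mem_iff : ∀ z (hz : z ∈ U) (m : ∀ c, M c),
    germ S.L U z hz (σ m) ∈ S.G.stalk z ↔ ∀ c : E, ¬ Outside (c : ℂ) z → m c = 0

lemma IsPairFrame.nonempty_decompositionOn {S : SheafPair k} {E : Finset ℂ}
    {M : E → ModuleCat.{u} k} {U : Opens Cstar.{u}} {σ : (∀ c, M c) →ₗ[k] Sec S.L U}
    (h : IsPairFrame S σ) : Nonempty (DecompositionOn S M U) := by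
  refine ⟨⟨fun V hV => (h.isFrame.secEquiv V hV).trans (locallyConstantPiEquiv M), ?_, ?_⟩⟩
  · intro V W hV hW s c z
    exact congrFun (h.isFrame.secEquiv_res hV hW s z) c
  · intro V hV s z
    rw [← h.isFrame.germ_coord hV s z, h.mem_iff]
    rfl

lemma DecompositionOn.exists_frame {S : SheafPair k} {E : Finset ℂ} {M : E → ModuleCat.{u} k}
    {U : Opens Cstar.{u}} (D : DecompositionOn S M U) :
    ∃ σ : (∀ c, M c) →ₗ[k] Sec S.L U, IsPairFrame S σ := by
  let C : ConstantOn S.L U (ModuleCat.of k (∀ c, M c)) :=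
    { equiv := fun V hV => (D.equiv V hV).trans (locallyConstantPiEquiv M).symm
      equiv_res := fun hV hW s z => funext fun c => D.equiv_res hV hW s c z }
  refine ⟨C.frame, C.isFrame, fun z hz m => ?_⟩
  rw [D.germ_mem_iff U le_rfl _ ⟨z, hz⟩]
  refine forall_congr' fun c => imp_congr_right fun _ => ?_
  have h : D.equiv U le_rfl (C.frame m) c ⟨z, hz⟩ = m c := by
    have := congrFun (C.equiv_frame m U le_rfl ⟨z, hz⟩) c
    rwa [show CoStokes.res S.L le_rfl (C.frame m) = C.frame m from
      sec_ext _ fun x hx => germ_res _ _ _ _ _] at this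
  rw [h]

lemma mem_sec_extByZero {F : Sh k X} {O : Set X} {U : Opens X} {s : Sec F U} :
    s ∈ (extByZero F O).sec U ↔ ∀ x (hx : x ∈ U), x ∉ O → germ F U x hx s = 0 := by
  classical
  refine forall₂_congr fun x hx => ?_
  by_cases h : x ∈ O <;> simp [h]

/-- Frames of the `gr c` are carried through the isomorphism. The condition on the filtration
concerns sections, and it passes to stalks because `{θ | c <_θ ξ}` is open. -/
lemma GradedIsoOn.exists_frame {S : FilteredSheaf k} {E : Finset ℂ} {gr : E → Sh k S1.{u}}
    {U : Opens S1.{u}} (D : GradedIsoOn S gr U) (hgr : ∀ c, IsLocalSystem (gr c)) {w : S1.{u}}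
    (hw : w ∈ U) : ∃ V : Opens S1.{u}, w ∈ V ∧ ∃ (M : E → ModuleCat.{u} k)
      (σ : (∀ c, M c) →ₗ[k] Sec S.L V), IsStokesFrame S σ := by
  choose O hO M τ₀ _ hτ₀ using fun c => (hgr c).exists_frame w
  obtain ⟨V₀, hwV₀, hV₀⟩ := exists_opens_forall (x := w) (fun c V => V ≤ O c)
    (fun c V W h h' => h.trans h') (fun c => ⟨O c, hO c, le_rfl⟩)
  let V := U ⊓ V₀
  have hVU : V ≤ U := inf_le_left
  let τ : ∀ c, M c →ₗ[k] Sec (gr c) V := fun c => res (gr c) (inf_le_right.trans (hV₀ c)) ∘ₗ τ₀ c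
  have hτ : ∀ c, IsFrame (τ c) := fun c => (hτ₀ c).res _
  let σ : (∀ c, M c) →ₗ[k] Sec S.L V :=
    (D.equiv V hVU).toLinearMap ∘ₗ LinearMap.pi fun c => τ c ∘ₗ LinearMap.proj c
  have hσ : ∀ m, σ m = D.equiv V hVU fun c => τ c (m c) := fun m => rfl
  have hσres : ∀ {W : Opens S1.{u}} (hW : W ≤ V) m, res S.L hW (σ m) =
      D.equiv W (hW.trans hVU) fun c => res (gr c) hW (τ c (m c)) := by
    intro W hW m
    rw [hσ, D.equiv_res hVU hW]
  refine ⟨V, ⟨hw, hwV₀⟩, M, σ, fun x hx => ⟨fun m n e => ?_, fun a => ?_⟩, fun x hx ξ m => ?_⟩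
  · obtain ⟨W, hW, hW', hxW, e⟩ := exists_res_eq S.L e
    rw [hσres, hσres] at e
    have e := (D.equiv W _).injective e
    funext c
    exact (hτ c x hx).1 (germ_eq_of_res_eq (gr c) (congrFun e c) x hxW)
  · obtain ⟨W, hW, hxW, s, rfl⟩ := exists_germ_le S.L hx a
    obtain ⟨t, rfl⟩ := (D.equiv W (hW.trans hVU)).surjective s
    choose m hm using fun c => (hτ c).exists_eq x hx (germ (gr c) W x hxW (t c))
    -- For each `c` the germ of `t c` is that of a frame section near `x`; as `E` is finite, one
    -- neighbourhood serves all `c`.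
    obtain ⟨W', hxW', hW'⟩ := exists_opens_forall (x := x)
      (fun c (W' : Opens S1.{u}) => ∃ (h : W' ≤ V) (h' : W' ≤ W),
        res (gr c) h (τ c (m c)) = res (gr c) h' (t c))
      (fun c A B hBA h => by
        obtain ⟨h, h', e⟩ := h
        exact ⟨hBA.trans h, hBA.trans h', by
          rw [← res_res _ h hBA, e, res_res]⟩)
      (fun c => by
        obtain ⟨W', h, h', hx', e⟩ := exists_res_eq (gr c) (hm c)
        exact ⟨W', hx', h, h', e⟩)
    have hx'' : x ∈ W ⊓ W' := ⟨hxW, hxW'⟩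
    refine ⟨m, germ_eq_of_res_eq S.L (W := W ⊓ W') (hWU := inf_le_left.trans hW)
      (hWV := inf_le_left) ?_ x hx''⟩
    rw [hσres, ← D.equiv_res (hW.trans hVU) inf_le_left]
    congr 1
    funext c
    obtain ⟨h, h', e⟩ := hW' c
    rw [← res_res (gr c) h inf_le_right, e, res_res]
  · constructor
    · rintro ⟨W, hxW, s, hs, e⟩ c hc
      obtain ⟨W', hW'W, hW'V, hxW', e⟩ := exists_res_eq S.L e
      have h := (S.fil ξ).res_mem hW'W hs
      rw [e, hσres, D.mem_fil_iff] at h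
      have h := mem_sec_extByZero.1 (h c) x hxW' hc
      rw [germ_res] at h
      exact (hτ c x hx).1 (h.trans (by simp))
    · intro h
      obtain ⟨W, hxW, hW⟩ := exists_opens_forall (x := x)
        (fun (c : E) (W : Opens S1.{u}) => ∀ y ∈ W, ¬ LtAt y c ξ → m c = 0)
        (fun i V W hWV h y hy => h y (hWV hy)) (fun c => by
          by_cases hc : LtAt x c ξ
          · exact ⟨⟨_, isOpen_ltAt c ξ⟩, hc, fun y hy hy' => (hy' hy).elim⟩
          · exact ⟨⊤, trivial, fun _ _ _ => h c hc⟩)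
      refine ⟨V ⊓ W, ⟨hx, hxW⟩, res S.L inf_le_left (σ m), ?_, germ_res _ _ _ _ _⟩
      rw [hσres, D.mem_fil_iff]
      refine fun c => mem_sec_extByZero.2 fun y hy hyc => ?_
      rw [hW c y hy.2 hyc]
      simp

lemma FilteredSheaf.IsCoStokes.exists_frame {S : FilteredSheaf k} {E : Finset ℂ}
    (h : S.IsCoStokes E) (w : S1.{u}) : ∃ V : Opens S1.{u}, w ∈ V ∧
      ∃ (M : E → ModuleCat.{u} k) (σ : (∀ c, M c) →ₗ[k] Sec S.L V), IsStokesFrame S σ := by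
  obtain ⟨gr, hgr, h⟩ := h.graded
  obtain ⟨U, hU, ⟨D⟩⟩ := h w
  exact D.exists_frame hgr hU

end Frames

/-! ### From co-Stokes structures to co-Stokes sheaves -/

section Assemble

variable {k : Type u} [Field k]

lemma pullStalk_mem_filAt {S : FilteredSheaf k} {ξ : ℂ} {z : Cstar.{u}} (a : Stalk S.L (proj z)) :
    pullStalk proj S.L z a ∈ filAt S ξ z ↔ a ∈ (S.fil ξ).stalk (proj z) := by
  refine ⟨?_, fun h => ⟨a, h, rfl⟩⟩
  rintro ⟨b, hb, e⟩
  rwa [← (pullStalk_bijective proj S.L z).1 e]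

lemma mem_iInf_filAt {S : FilteredSheaf k} {z : Cstar.{u}}
    (a : Stalk ((pull k proj).obj S.L) z) :
    a ∈ (⨅ (ξ : ℂ) (_ : z ∈ curve.{u} ξ), filAt S ξ z) ↔
      ∀ ξ : ℂ, z ∈ curve.{u} ξ → a ∈ filAt S ξ z := by
  simp only [Submodule.mem_iInf]

lemma IsStokesFrame.germ_pull_mem_filAt {S : FilteredSheaf k} {E : Finset ℂ}
    {M : E → ModuleCat.{u} k} {U : Opens S1.{u}} {σ : (∀ c, M c) →ₗ[k] Sec S.L U}
    (h : IsStokesFrame S σ) {ξ : ℂ} {z : Cstar.{u}} (hz : z ∈ sector U) (hξ : z ∈ curve.{u} ξ)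
    (m : ∀ c, M c) :
    germ ((pull k proj).obj S.L) (sector U) z hz ((pullSec proj S.L U ∘ₗ σ) m) ∈ filAt S ξ z ↔
      ∀ c : E, ¬ Outside (c : ℂ) z → m c = 0 := by
  rw [LinearMap.comp_apply, ← pullStalk_germ proj S.L z U hz hz, pullStalk_mem_filAt]
  simp only [outside_iff_of_mem_curve hξ]
  exact h.mem_iff (proj z) hz ξ m

/-- In the frame, all the subspaces `filAt S ξ z` with `z ∈ S_ξ` are given by the same condition,
namely that the coordinates with `S_c < z` are the only nonzero ones. So their intersection is any
one of them, and openness of `{z | S_c < z}` makes it the stalk of `G`. -/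
lemma IsStokesFrame.pull {S : FilteredSheaf k} {E : Finset ℂ}
    {M : E → ModuleCat.{u} k} {U : Opens S1.{u}} {σ : (∀ c, M c) →ₗ[k] Sec S.L U}
    (h : IsStokesFrame S σ) : IsPairFrame (assemble S) (pullSec proj S.L U ∘ₗ σ) where
  isFrame := h.isFrame.pull proj
  mem_iff := by
    refine isFrame_mem_stalk_ofStalks (A := fun c : E => {z | Outside (c : ℂ) z})
      (fun c => isOpen_outside (c : ℂ)) fun z hz m => ?_
    refine (mem_iInf_filAt _).trans ?_
    constructor
    · intro H
      obtain ⟨ξ, hξ⟩ := exists_mem_curve z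
      exact (h.germ_pull_mem_filAt hz hξ m).1 (H ξ hξ)
    · exact fun H ξ hξ => (h.germ_pull_mem_filAt hz hξ m).2 H

lemma FilteredSheaf.IsCoStokes.isCoStokesSheaf {S : FilteredSheaf k} {E : Finset ℂ}
    (h : S.IsCoStokes E) : (assemble S).IsCoStokesSheaf E where
  isLocalSystem := h.isLocalSystem.pull proj
  decomposition z := by
    obtain ⟨V, hV, M, σ, hσ⟩ := h.exists_frame (proj z)
    exact ⟨sector V, hV, ⟨_, ⟨hσ.pull.isFrame.constantOn⟩⟩, M, hσ.pull.nonempty_decompositionOn⟩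

lemma FilteredSheaf.IsCoStokes.stalk_assemble {S : FilteredSheaf k} {E : Finset ℂ}
    (h : S.IsCoStokes E) {ξ : ℂ} {z : Cstar.{u}} (hz : z ∈ curve.{u} ξ) :
    (assemble S).G.stalk z = filAt S ξ z := by
  obtain ⟨V, hV, M, σ, hσ⟩ := h.exists_frame (proj z)
  ext a
  obtain ⟨m, rfl⟩ := hσ.pull.isFrame.exists_eq z hV a
  rw [hσ.pull.mem_iff z hV m]
  exact (hσ.germ_pull_mem_filAt hV hz m).symm

end Assemble

/-! ### `σ` is fully faithful -/

section FullyFaithful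

variable {k : Type u} [Field k]

/-- The direct image under `π`. -/
abbrev push (F : Sh k Cstar.{u}) : Sh k S1.{u} :=
  (TopCat.Sheaf.pushforward (ModuleCat.{u} k) proj).obj F

lemma germ_sector_eq_of_germ_push_eq {F : Sh k Cstar.{u}} {U V : Opens S1.{u}} {w : S1.{u}}
    {hU : w ∈ U} {hV : w ∈ V} {s : Sec F (sector U)} {t : Sec F (sector V)}
    (h : germ (push F) U w hU s = germ (push F) V w hV t) {z : Cstar.{u}} (hz : z ∈ ray w) :
    germ F (sector U) z (ray_subset_sector hU hz) s =
      germ F (sector V) z (ray_subset_sector hV hz) t := by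
  obtain ⟨W, hWU, hWV, hw, e⟩ := exists_res_eq _ h
  have e' : res F (sector_mono hWU) s = res F (sector_mono hWV) t := e
  exact germ_eq_of_res_eq F e' z (ray_subset_sector hw hz)

/-- Sectors over connected arcs form a neighbourhood basis for `π_* F` and are connected, so a germ
of `π_* F` is determined at any single point of the ray. -/
lemma IsLocalSystem.germ_push_eq {F : Sh k Cstar.{u}} (hF : IsLocalSystem F) {U V : Opens S1.{u}}
    {w : S1.{u}} {hU : w ∈ U} {hV : w ∈ V} {s : Sec F (sector U)} {t : Sec F (sector V)}
    {z : Cstar.{u}} (hz : z ∈ ray w)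
    (h : germ F (sector U) z (ray_subset_sector hU hz) s =
      germ F (sector V) z (ray_subset_sector hV hz) t) :
    germ (push F) U w hU s = germ (push F) V w hV t := by
  obtain ⟨W, hW, hwW, hWc⟩ := exists_preconnected_opens (U := U ⊓ V) ⟨hU, hV⟩
  have hWU : W ≤ U := hW.trans inf_le_left
  have hWV : W ≤ V := hW.trans inf_le_right
  refine germ_eq_of_res_eq _ (W := W) (hWU := hWU) (hWV := hWV) ?_ w hwW
  change res F (sector_mono hWU) s = res F (sector_mono hWV) t
  refine sec_ext _ fun x hx => ?_
  rw [germ_res, germ_res]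
  exact hF.germ_eq_of_isPreconnected (isPreconnected_sector hWc)
    (sector_mono hWU) (sector_mono hWV) (ray_subset_sector hwW hz) h hx

/-- Evaluation at a point `z` over the given direction reduces both halves to the stalk of `π^* L`
at `z`, which is that of `L`. Surjectivity uses that a pulled back frame reaches every germ at `z`,
and that the germ at `z` determines the germ of `π_* π^* L`. -/
lemma onStalk_unit_bijective {L : Sh k S1.{u}} (hL : IsLocalSystem L) (w : S1.{u}) :
    Function.Bijective (onStalk
      ((TopCat.Sheaf.pullbackPushforwardAdjunction (ModuleCat.{u} k) proj.{u}).unit.app L) w) := by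
  obtain ⟨z, rfl⟩ : ∃ z, proj z = w := ⟨polar w 0, proj_polar w 0⟩
  set η := (TopCat.Sheaf.pullbackPushforwardAdjunction (ModuleCat.{u} k) proj.{u}).unit.app L
  have hη : ∀ (U : Opens S1.{u}) (hU : proj z ∈ U) (s : Sec L U),
      onStalk η (proj z) (germ L U (proj z) hU s) =
        germ (push ((pull k proj).obj L)) U (proj z) hU (pullSec proj L U s) :=
    fun U hU s => onStalk_germ η U (proj z) hU s
  constructor
  · intro a b e
    obtain ⟨U, hU, s, rfl⟩ := exists_germ L (proj z) a
    obtain ⟨V, hV, t, rfl⟩ := exists_germ L (proj z) b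
    rw [hη, hη] at e
    have e' := germ_sector_eq_of_germ_push_eq e rfl
    apply (pullStalk_bijective proj L z).1
    exact (pullStalk_germ proj L z U hU hU s).trans (e'.trans (pullStalk_germ proj L z V hV hV t).symm)
  · intro b
    obtain ⟨U, hU, M, σ, -, hσ⟩ := hL.exists_frame (proj z)
    obtain ⟨V, hV, t, rfl⟩ := exists_germ (push ((pull k proj).obj L)) (proj z) b
    obtain ⟨m, hm⟩ := (hσ.pull proj).exists_eq z hU
      (germ ((pull k proj).obj L) (sector V) z hV t)
    refine ⟨germ L U (proj z) hU (σ m), ?_⟩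
    rw [hη]
    exact (hL.pull proj).germ_push_eq rfl hm

lemma exists_pull_map_eq {L L' : Sh k S1.{u}} (hL' : IsLocalSystem L')
    (h : (pull k proj.{u}).obj L ⟶ (pull k proj.{u}).obj L') :
    ∃ f : L ⟶ L', (pull k proj.{u}).map f = h := by
  let adj := TopCat.Sheaf.pullbackPushforwardAdjunction (ModuleCat.{u} k) proj.{u}
  have : IsIso (adj.unit.app L') := isIso_of_onStalk_bijective _ (onStalk_unit_bijective hL')
  refine ⟨adj.unit.app L ≫ (TopCat.Sheaf.pushforward _ proj).map h ≫ inv (adj.unit.app L'), ?_⟩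
  apply (adj.homEquiv _ _).injective
  rw [Adjunction.homEquiv_unit, Adjunction.homEquiv_unit]
  refine (adj.unit_naturality _).trans ?_
  rw [Category.assoc, Category.assoc, IsIso.inv_hom_id, Category.comp_id]

lemma pull_map_injective {L L' : Sh k S1.{u}} {f g : L ⟶ L'}
    (h : (pull k proj.{u}).map f = (pull k proj.{u}).map g) : f = g := by
  refine hom_ext_of_stalk fun w a => ?_
  obtain ⟨z, rfl⟩ : ∃ z, proj z = w := ⟨polar w 0, proj_polar w 0⟩
  apply (pullStalk_bijective proj L' z).1
  rw [← onStalk_pullStalk, ← onStalk_pullStalk, h]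

lemma SheafPair.Hom.onStalk_mem {S T : SheafPair k} (f : S ⟶ T) {z : Cstar.{u}}
    {a : Stalk S.L z} (ha : a ∈ S.G.stalk z) : onStalk f.hom z a ∈ T.G.stalk z := by
  obtain ⟨U, hU, s, hs, rfl⟩ := ha
  exact ⟨U, hU, _, f.map_sub U s hs, (onStalk_germ f.hom U z hU s).symm⟩

/-- The underlying morphism descends by adjunction. It respects the filtrations because `L_{<ξ}` at
`w` is recovered as the stalk of `G` at `i_ξ(w)`. -/
lemma exists_assemble_map_eq {S T : FilteredSheaf k} {E E' : Finset ℂ} (hS : S.IsCoStokes E)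
    (hT : T.IsCoStokes E') (h : assemble S ⟶ assemble T) :
    ∃ f : S ⟶ T, (assembleFunctor k).map f = h := by
  obtain ⟨f, hf⟩ := exists_pull_map_eq hT.isLocalSystem h.hom
  refine ⟨⟨f, fun ξ U s hs => (T.fil ξ).mem_sec_iff.2 fun w hw => ?_⟩, SheafPair.Hom.ext hf⟩
  have hz : param ξ w ∈ curve.{u} ξ := param_mem_curve ξ w
  have key : ∀ a ∈ (S.fil ξ).stalk (proj (param ξ w)),
      onStalk f (proj (param ξ w)) a ∈ (T.fil ξ).stalk (proj (param ξ w)) := by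
    intro a ha
    rw [← pullStalk_mem_filAt, ← onStalk_pullStalk, ← hT.stalk_assemble hz, hf]
    refine SheafPair.Hom.onStalk_mem h ?_
    rw [hS.stalk_assemble hz]
    exact (pullStalk_mem_filAt a).2 ha
  rw [proj_param] at key
  rw [← onStalk_germ]
  exact key _ ((S.fil ξ).germ_mem_stalk hs w hw)

variable (h : ∀ (E : Finset ℂ) (S : FilteredSheaf k),
    S.IsCoStokes E → ((assembleFunctor k).obj S).IsCoStokesSheaf E)

instance sigma_faithful : (sigma h).Faithful where
  map_injective {S T f g} e := by
    have e' : (assembleFunctor k).map f.hom = (assembleFunctor k).map g.hom :=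
      congrArg (fun x => x.hom) e
    have e'' : (pull k proj.{u}).map f.hom.hom = (pull k proj.{u}).map g.hom.hom :=
      congrArg SheafPair.Hom.hom e'
    apply ObjectProperty.hom_ext
    exact FilteredSheaf.Hom.ext (pull_map_injective e'')

instance sigma_full : (sigma h).Full where
  map_surjective {S T} g := by
    obtain ⟨E, hS⟩ := S.property
    obtain ⟨E', hT⟩ := T.property
    obtain ⟨f, hf⟩ := exists_assemble_map_eq hS hT g.hom
    exact ⟨ObjectProperty.homMk f, ObjectProperty.hom_ext _ hf⟩

end FullyFaithful

/-! ### Linear algebra: gluing direct sum decompositions -/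

section Splitting

variable {k : Type*} [Field k] {V : Type*} [AddCommGroup V] [Module k V] {ι : Type*}

open Classical in
/-- The family that agrees with `N` on `A` and with `N'` elsewhere. -/
def glue (N N' : ι → Submodule k V) (A : Set ι) (i : ι) : Submodule k V :=
  if i ∈ A then N i else N' i

lemma glue_of_mem (N N' : ι → Submodule k V) {A : Set ι} {i : ι} (h : i ∈ A) :
    glue N N' A i = N i := if_pos h

lemma glue_of_notMem (N N' : ι → Submodule k V) {A : Set ι} {i : ι} (h : i ∉ A) :
    glue N N' A i = N' i := if_neg h

variable [Fintype ι]

/-- `V` is the internal direct sum of the subspaces `N i`. -/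
structure IsSplitting (N : ι → Submodule k V) : Prop where
  eq_zero : ∀ m : ι → V, (∀ i, m i ∈ N i) → ∑ i, m i = 0 → ∀ i, m i = 0
  exists_sum : ∀ v, ∃ m : ι → V, (∀ i, m i ∈ N i) ∧ ∑ i, m i = v

/-- `v` lies in the sum of the `N i`, `i ∈ A`. -/
def InPart (N : ι → Submodule k V) (A : Set ι) (v : V) : Prop :=
  ∃ m : ι → V, (∀ i, m i ∈ N i) ∧ (∀ i ∉ A, m i = 0) ∧ ∑ i, m i = v

lemma inPart_empty {N : ι → Submodule k V} {A : Set ι} (hA : ∀ i, i ∉ A) (v : V) :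
    InPart N A v ↔ v = 0 := by
  constructor
  · rintro ⟨m, -, h, rfl⟩
    exact Finset.sum_eq_zero fun i _ => h i (hA i)
  · rintro rfl
    exact ⟨0, fun i => zero_mem _, fun _ _ => rfl, by simp⟩

lemma IsSplitting.inPart_univ {N : ι → Submodule k V} (h : IsSplitting N) {A : Set ι}
    (hA : ∀ i, i ∈ A) (v : V) : InPart N A v := by
  obtain ⟨m, hm, e⟩ := h.exists_sum v
  exact ⟨m, hm, fun i hi => (hi (hA i)).elim, e⟩

/-- The part of a sum that is indexed by `A` can be replaced by another sum with the same value. -/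
lemma exists_sum_replace {N' : ι → Submodule k V} {A : Set ι} {m m' : ι → V}
    (hm : ∀ i ∉ A, m i ∈ N' i) (hm' : ∀ i, m' i ∈ N' i) (h0 : ∀ i ∉ A, m' i = 0)
    [DecidablePred (· ∈ A)] (e : ∑ i, m' i = ∑ i, if i ∈ A then m i else 0) :
    ∃ n : ι → V, (∀ i, n i ∈ N' i) ∧ (∀ i ∉ A, n i = m i) ∧ (∀ i ∈ A, n i = m' i) ∧
      ∑ i, n i = ∑ i, m i := by
  refine ⟨fun i => m' i + if i ∈ A then 0 else m i, fun i => ?_, fun i hi => ?_, fun i hi => ?_, ?_⟩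
  · refine add_mem (hm' i) ?_
    split_ifs with hi
    · exact zero_mem _
    · exact hm i hi
  · simp [hi, h0 i hi]
  · simp [hi]
  · rw [Finset.sum_add_distrib, e, ← Finset.sum_add_distrib]
    refine Finset.sum_congr rfl fun i _ => ?_
    split_ifs <;> simp

lemma inPart_glue_of_subset (N N' : ι → Submodule k V) {A B : Set ι} (hB : B ⊆ A) (v : V) :
    InPart (glue N N' A) B v ↔ InPart N B v := by
  refine exists_congr fun m => ?_
  constructor
  · rintro ⟨hm, h0, e⟩
    refine ⟨fun i => ?_, h0, e⟩
    by_cases hi : i ∈ B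
    · rw [← glue_of_mem N N' (hB hi)]
      exact hm i
    · rw [h0 i hi]
      exact zero_mem _
  · rintro ⟨hm, h0, e⟩
    refine ⟨fun i => ?_, h0, e⟩
    by_cases hi : i ∈ B
    · rw [glue_of_mem N N' (hB hi)]
      exact hm i
    · rw [h0 i hi]
      exact zero_mem _

/-- The components indexed by `A` can be exchanged between `N` and `N'` since both have the same sum
over `A`; the remaining components are already those of `N'`. -/
lemma inPart_glue_of_superset {N N' : ι → Submodule k V} {A B : Set ι} (hB : A ⊆ B)
    (h : ∀ v, InPart N A v ↔ InPart N' A v) (v : V) :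
    InPart (glue N N' A) B v ↔ InPart N' B v := by
  classical
  have aux : ∀ P P' : ι → Submodule k V, (∀ v, InPart P A v → InPart P' A v) →
      (∀ i ∉ A, P i = P' i) → InPart P B v → InPart P' B v := by
    rintro P P' hPP' hP ⟨m, hm, h0, rfl⟩
    obtain ⟨m', hm', h0', e⟩ := hPP' (∑ i, if i ∈ A then m i else 0)
      ⟨fun i => if i ∈ A then m i else 0, fun i => by
        dsimp only
        split_ifs
        · exact hm i
        · exact zero_mem _, fun i hi => by simp [hi], rfl⟩
    obtain ⟨n, hn, hn', -, e⟩ := exists_sum_replace (N' := P')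
      (fun i hi => hP i hi ▸ hm i) hm' h0' e
    exact ⟨n, hn, fun i hi => (hn' i fun h => hi (hB h)).trans (h0 i hi), e⟩
  constructor
  · exact aux _ _ (fun v hv => (h v).1 ((inPart_glue_of_subset N N' subset_rfl v).1 hv))
      fun i hi => glue_of_notMem N N' hi
  · exact aux _ _ (fun v hv => (inPart_glue_of_subset N N' subset_rfl v).2 ((h v).2 hv))
      fun i hi => (glue_of_notMem N N' hi).symm

/-- The sum of the `N i` over `A` is that of the `N' i` over `A`, and the latter is complemented by
the sum of the other `N' i`. -/
lemma IsSplitting.glue {N N' : ι → Submodule k V} (hN : IsSplitting N) (hN' : IsSplitting N')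
    {A : Set ι} (h : ∀ v, InPart N A v ↔ InPart N' A v) : IsSplitting (glue N N' A) where
  eq_zero m hm e := by
    classical
    have hA : ∀ i ∈ A, m i ∈ N i := fun i hi => glue_of_mem N N' hi ▸ hm i
    have hA' : ∀ i ∉ A, m i ∈ N' i := fun i hi => glue_of_notMem N N' hi ▸ hm i
    have hin : ∀ i, (if i ∈ A then m i else 0) ∈ N i := fun i => by
      split_ifs with hi
      · exact hA i hi
      · exact zero_mem _
    obtain ⟨m', hm', h0', e'⟩ := (h (∑ i, if i ∈ A then m i else 0)).1
      ⟨fun i => if i ∈ A then m i else 0, hin, fun i hi => by simp [hi], rfl⟩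
    obtain ⟨n, hn, hn1, hn2, en⟩ := exists_sum_replace hA' hm' h0' e'
    have hz := hN'.eq_zero n hn (en.trans e)
    have hm0 : ∀ i ∉ A, m i = 0 := fun i hi => (hn1 i hi).symm.trans (hz i)
    have es : ∑ i, (if i ∈ A then m i else 0) = 0 := by
      refine (Finset.sum_congr rfl fun i _ => ?_).trans e
      split_ifs with hi
      · rfl
      · exact (hm0 i hi).symm
    have := hN.eq_zero _ hin es
    intro i
    by_cases hi : i ∈ A
    · simpa [hi] using this i
    · exact hm0 i hi
  exists_sum v := by
    obtain ⟨m, hm, -, e⟩ := (inPart_glue_of_superset (Set.subset_univ A) h v).2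
      (hN'.inPart_univ (A := Set.univ) (fun _ => trivial) v)
    exact ⟨m, hm, e⟩

/-- Splittings that are adapted to `G` near each point of the line `{x} × ℝ` can be glued to one
that is adapted to `G` near the whole line. -/
lemma exists_splitting_near_line {T : Type*} [TopologicalSpace T] (x : T) {f : ι → T → ℝ}
    (hf : ∀ i, Continuous (f i)) (G : T → ℝ → Set V)
    (hloc : ∀ t, ∃ N : ι → Submodule k V, IsSplitting N ∧
      ∀ᶠ p : T × ℝ in nhds (x, t), ∀ v, v ∈ G p.1 p.2 ↔ InPart N {i | f i p.1 < p.2} v)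
    (hbot : ∀ᶠ y in nhds x, ∀ t v, (∀ i, ¬ f i y < t) → (v ∈ G y t ↔ v = 0))
    (htop : ∀ᶠ y in nhds x, ∀ t v, (∀ i, f i y < t) → v ∈ G y t) :
    ∃ N : ι → Submodule k V, IsSplitting N ∧
      ∀ᶠ y in nhds x, ∀ t v, v ∈ G y t ↔ InPart N {i | f i y < t} v := by
  -- `Q b` says that one splitting works near `x` for all levels up to `b`. The supremum of such `b`
  -- will be shown not to be finite.
  let Q : ℝ → Prop := fun b => ∃ N : ι → Submodule k V, IsSplitting N ∧
      ∀ᶠ y in nhds x, ∀ t ≤ b, ∀ v, v ∈ G y t ↔ InPart N {i | f i y < t} v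
  have hmono : ∀ {b b'}, b ≤ b' → Q b' → Q b := by
    rintro b b' hb ⟨N, hN, h⟩
    exact ⟨N, hN, h.mono fun y hy t ht => hy t (ht.trans hb)⟩
  have hstep : ∀ {b d}, b ≤ d → (∀ i, f i x ≠ b) → Q b → (∃ N : ι → Submodule k V, IsSplitting N ∧
      ∀ᶠ y in nhds x, ∀ t, b ≤ t → t ≤ d → ∀ v, v ∈ G y t ↔ InPart N {i | f i y < t} v) → Q d := by
    rintro b d hbd hb ⟨N, hN, h⟩ ⟨N', hN', h'⟩
    -- Gluing takes place at a level `b` that no `f i x` equals, so that the set of indices below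
    -- `b` is the same for all `y` near `x`.
    have hA : ∀ᶠ y in nhds x, ∀ i, f i y < b ↔ f i x < b := by
      rw [Filter.eventually_all]
      intro i
      rcases (hb i).lt_or_gt with hi | hi
      · filter_upwards [(hf i).continuousAt.eventually_lt continuousAt_const hi] with y hy
        exact iff_of_true hy hi
      · filter_upwards [continuousAt_const.eventually_lt (hf i).continuousAt hi] with y hy
        exact iff_of_false hy.not_gt hi.not_gt
    let A : Set ι := {i | f i x < b}
    -- At `(x, b)` both splittings describe `G x b` by the same index set `A`.
    have hNN' : ∀ v, InPart N A v ↔ InPart N' A v := fun v =>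
      (h.self_of_nhds b le_rfl v).symm.trans (h'.self_of_nhds b le_rfl hbd v)
    refine ⟨glue N N' A, hN.glue hN' hNN', ?_⟩
    filter_upwards [h, h', hA] with y hy hy' hyA t ht v
    rcases le_total t b with htb | htb
    · rw [hy t htb v, inPart_glue_of_subset]
      exact fun i hi => (hyA i).1 (lt_of_lt_of_le hi htb)
    · rw [hy' t htb ht v, inPart_glue_of_superset _ hNN']
      exact fun i hi => lt_of_lt_of_le ((hyA i).2 hi) htb
  have hbounds : ∀ s : ι → ℝ, (∃ a, ∀ i, a < s i) ∧ ∃ b, ∀ i, s i < b := by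
    intro s
    obtain ⟨a, ha⟩ := (Set.finite_range s).bddBelow
    obtain ⟨b, hb⟩ := (Set.finite_range s).bddAbove
    exact ⟨⟨a - 1, fun i => by linarith [ha ⟨i, rfl⟩]⟩, b + 1, fun i => by linarith [hb ⟨i, rfl⟩]⟩
  have hall : ∀ b, Q b := by
    by_contra hne
    push Not at hne
    obtain ⟨B, hB⟩ := hne
    obtain ⟨a, ha⟩ := (hbounds fun i => f i x).1
    -- Below all the graphs `G` is zero, so any splitting is adapted there.
    have hQa : Q a := by
      obtain ⟨N, hN, -⟩ := hloc a
      refine ⟨N, hN, ?_⟩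
      have : ∀ᶠ y in nhds x, ∀ i, a < f i y := by
        rw [Filter.eventually_all]
        exact fun i => continuousAt_const.eventually_lt (hf i).continuousAt (ha i)
      filter_upwards [this, hbot] with y hy hy' t ht v
      have hlt : ∀ i, ¬ f i y < t := fun i => (ht.trans (hy i).le).not_gt
      rw [hy' t v hlt, inPart_empty (A := {i | f i y < t}) hlt]
    have hbdd : BddAbove {b | Q b} := ⟨B, fun b hb => le_of_not_ge fun h => hB (hmono h hb)⟩
    obtain ⟨N, hN, h⟩ := hloc (sSup {b | Q b})
    set s := sSup {b | Q b}
    rw [nhds_prod_eq, Filter.eventually_prod_iff] at h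
    obtain ⟨pa, hpa, pb, hpb, h⟩ := h
    obtain ⟨ε, hε, hpb⟩ := Metric.eventually_nhds_iff.1 hpb
    -- A splitting adapted near `(x, s)` covers the levels within `ε` of the supremum `s`. It is
    -- glued to the one from below at a level `b'` between `s - ε` and `s` that avoids the finitely
    -- many `f i x`, which gives `Q (s + ε / 2)`.
    obtain ⟨b, hb, hsb⟩ := exists_lt_of_lt_csSup (s := {b | Q b}) ⟨a, hQa⟩
      (show s - ε < s by linarith)
    have hbs : b ≤ s := le_csSup hbdd hb
    obtain ⟨b', hb', hb'f⟩ := (Set.Ioo_infinite hsb).exists_notMem_finset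
      (Finset.univ.image fun i => f i x)
    have hb'f : ∀ i, f i x ≠ b' := fun i e => hb'f (by simp [← e])
    have hQ : Q (s + ε / 2) := by
      refine hstep (by linarith [hb'.2]) hb'f (hmono hb'.2.le hb) ⟨N, hN, ?_⟩
      filter_upwards [hpa] with y hy t ht ht'
      refine h hy (hpb ?_)
      rw [Real.dist_eq, abs_lt]
      constructor <;> linarith [hb'.1]
    linarith [le_csSup hbdd hQ]
  -- Above all the graphs `G` is everything, so a splitting that works up to such a level works for
  -- all levels.
  obtain ⟨b, hb⟩ := (hbounds fun i => f i x).2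
  obtain ⟨N, hN, h⟩ := hall b
  refine ⟨N, hN, ?_⟩
  have : ∀ᶠ y in nhds x, ∀ i, f i y < b := by
    rw [Filter.eventually_all]
    exact fun i => (hf i).continuousAt.eventually_lt continuousAt_const (hb i)
  filter_upwards [this, h, htop] with y hy hyb hyt t v
  rcases le_total t b with htb | htb
  · exact hyb t htb v
  · have hlt : ∀ i, f i y < t := fun i => (hy i).trans_le htb
    exact iff_of_true (hyt t v hlt) (hN.inPart_univ hlt v)

end Splitting

/-! ### Adapted decompositions along whole rays -/

section SectorFrame

variable {k : Type u} [Field k]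

lemma IsSplitting.exists_equiv {V : Type*} [AddCommGroup V] [Module k V] {ι : Type*} [Fintype ι]
    {N : ι → Submodule k V} (h : IsSplitting N) : ∃ B : (∀ i, N i) ≃ₗ[k] V,
      ∀ (A : Set ι) m, InPart N A (B m) ↔ ∀ i ∉ A, m i = 0 := by
  let f : (∀ i, N i) →ₗ[k] V := ∑ i, (N i).subtype ∘ₗ LinearMap.proj i
  have hf : ∀ m, f m = ∑ i, (m i : V) := fun m => by simp [f]
  have hinj : Function.Injective f := by
    rw [injective_iff_map_eq_zero]
    intro m hm
    rw [hf] at hm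
    funext i
    exact Subtype.ext (h.eq_zero (fun i => (m i : V)) (fun i => (m i).2) hm i)
  refine ⟨LinearEquiv.ofBijective f ⟨hinj, fun v => ?_⟩, fun A m => ⟨?_, fun h0 => ?_⟩⟩
  · obtain ⟨m, hm, rfl⟩ := h.exists_sum v
    exact ⟨fun i => ⟨m i, hm i⟩, hf _⟩
  · rintro ⟨n, hn, h0, e⟩ i hi
    have : (fun i => ⟨n i, hn i⟩) = m := hinj ((hf _).trans e)
    rw [← this]
    exact Subtype.ext (h0 i hi)
  · exact ⟨fun i => m i, fun i => (m i).2, fun i hi => congrArg Subtype.val (h0 i hi), (hf m).symm⟩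

lemma exists_splitting_of_equiv {V : Type*} [AddCommGroup V] [Module k V] {ι : Type*} [Fintype ι]
    {M : ι → Type*} [∀ i, AddCommGroup (M i)] [∀ i, Module k (M i)] (B : (∀ i, M i) ≃ₗ[k] V) :
    ∃ N : ι → Submodule k V, IsSplitting N ∧
      ∀ (A : Set ι) v, InPart N A v ↔ ∀ i ∉ A, B.symm v i = 0 := by
  classical
  let N : ι → Submodule k V := fun i =>
    LinearMap.range (B.toLinearMap ∘ₗ LinearMap.single k M i)
  have hsum : ∀ x : ∀ i, M i, ∑ i, B (Pi.single i (x i)) = B x := fun x => by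
    rw [← map_sum, Finset.univ_sum_single]
  have hN : ∀ x : ∀ i, M i, ∀ i, B (Pi.single i (x i)) ∈ N i := fun x i => ⟨x i, rfl⟩
  have hex : ∀ m : ι → V, (∀ i, m i ∈ N i) →
      ∃ x : ∀ i, M i, (∀ i, B (Pi.single i (x i)) = m i) ∧ B x = ∑ i, m i := by
    intro m hm
    choose x hx using hm
    refine ⟨x, hx, ?_⟩
    rw [← hsum]
    exact Finset.sum_congr rfl fun i _ => hx i
  refine ⟨N, ⟨fun m hm e i => ?_, fun v => ?_⟩, fun A v => ⟨?_, fun h => ?_⟩⟩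
  · obtain ⟨x, hx, e'⟩ := hex m hm
    have : x = 0 := B.injective (by rw [e', e, map_zero])
    rw [← hx i, this]
    simp
  · exact ⟨_, hN (B.symm v), by rw [hsum, B.apply_symm_apply]⟩
  · rintro ⟨m, hm, h0, rfl⟩ i hi
    obtain ⟨x, hx, e'⟩ := hex m hm
    rw [← e', B.symm_apply_apply]
    have := hx i
    rw [h0 i hi, LinearEquiv.map_eq_zero_iff] at this
    simpa using this
  · refine ⟨_, hN (B.symm v), fun i hi => ?_, by rw [hsum, B.apply_symm_apply]⟩
    rw [h i hi]
    simp

/-- Near each point of a sector over which `L` is trivialized, the subsheaf is given by a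
decomposition of the fibre. -/
lemma SheafPair.IsCoStokesSheaf.exists_local_equiv {S : SheafPair k} {E : Finset ℂ}
    (h : S.IsCoStokesSheaf E) {O : Opens Cstar.{u}} {V : ModuleCat.{u} k}
    {σ : V →ₗ[k] Sec S.L O} (hσ : IsFrame σ) {z : Cstar.{u}} (hz : z ∈ O) :
    ∃ (M : E → ModuleCat.{u} k) (B : (∀ c, M c) ≃ₗ[k] V) (U : Opens Cstar.{u}) (_ : U ≤ O),
      z ∈ U ∧ ∀ z' (hz' : z' ∈ O), z' ∈ U → ∀ v, germ S.L O z' hz' (σ v) ∈ S.G.stalk z' ↔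
        ∀ c : E, ¬ Outside (c : ℂ) z' → B.symm v c = 0 := by
  obtain ⟨U₀, hzU₀, -, M, ⟨D⟩⟩ := h.decomposition z
  obtain ⟨τ, hτ⟩ := D.exists_frame
  obtain ⟨U, hU, hzU, hUc⟩ := exists_preconnected_opens (U := U₀ ⊓ O) ⟨hzU₀, hz⟩
  have hUU₀ : U ≤ U₀ := hU.trans inf_le_left
  have hUO : U ≤ O := hU.trans inf_le_right
  -- The two frames are compared at `z` alone; connectedness of `U` propagates the comparison to all
  -- of `U`.
  let B := (hτ.isFrame.stalkEquiv z hzU₀).trans (hσ.stalkEquiv z hz).symm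
  refine ⟨M, B, U, hUO, hzU, fun z' hz' hz'U v => ?_⟩
  have e : germ S.L U₀ z' (hUU₀ hz'U) (τ (B.symm v)) = germ S.L O z' hz' (σ v) := by
    refine h.isLocalSystem.germ_eq_of_isPreconnected hUc hUU₀ hUO hzU ?_ hz'U
    exact hτ.isFrame.germ_stalkEquiv_symm z hzU₀ _
  rw [← e]
  exact hτ.mem_iff z' _ _

/-- A co-Stokes sheaf has adapted frames over sectors. -/
lemma SheafPair.IsCoStokesSheaf.exists_sector_frame {S : SheafPair k} {E : Finset ℂ}
    (h : S.IsCoStokesSheaf E) (w : S1.{u}) : ∃ W : Opens S1.{u}, w ∈ W ∧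
      ∃ (M : E → ModuleCat.{u} k) (σ : (∀ c, M c) →ₗ[k] Sec S.L (sector W)),
        (∀ c, Module.Finite k (M c)) ∧ IsPairFrame S σ := by
  obtain ⟨W₀, hw, V, σ, hV, hσ⟩ := h.isLocalSystem.exists_sector_frame w
  have hW₀ : ∀ᶠ y in nhds w, y ∈ W₀ := W₀.2.mem_nhds hw
  -- The stalks of `G` in polar coordinates, read in the fibre `V`. For `y` outside `W₀` the value
  -- is a default, the empty set; only `y` near `w` matter.
  let G : S1.{u} → ℝ → Set V := fun y t => {v | ∃ hy : y ∈ W₀,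
    germ S.L (sector W₀) (polar y t) (polar_mem_sector hy t) (σ v) ∈ S.G.stalk (polar y t)}
  have hG : ∀ y (hy : y ∈ W₀) t v, v ∈ G y t ↔ germ S.L (sector W₀) (polar y t)
      (polar_mem_sector hy t) (σ v) ∈ S.G.stalk (polar y t) :=
    fun y hy t v => ⟨fun ⟨_, h⟩ => h, fun h => ⟨hy, h⟩⟩
  obtain ⟨N, hN, hNG⟩ := exists_splitting_near_line w
    (f := fun (c : E) (y : S1.{u}) => ((c : ℂ) * (y.down : ℂ)⁻¹).re)
    (fun c => continuous_re_mul_inv (c : ℂ)) G (k := k) (by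
      intro t
      obtain ⟨M, B, U, hU, hzU, hB⟩ := h.exists_local_equiv hσ (polar_mem_sector hw t)
      obtain ⟨N, hN, hNB⟩ := exists_splitting_of_equiv B
      refine ⟨N, hN, ?_⟩
      have h1 : ∀ᶠ p : S1.{u} × ℝ in nhds (w, t), polar p.1 p.2 ∈ U :=
        continuous_polar.continuousAt.eventually_mem (U.2.mem_nhds hzU)
      have h2 : ∀ᶠ p : S1.{u} × ℝ in nhds (w, t), p.1 ∈ W₀ :=
        continuous_fst.continuousAt.eventually_mem (W₀.2.mem_nhds hw)
      filter_upwards [h1, h2] with p hp hp' v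
      rw [hG p.1 hp', hB _ _ hp, hNB]
      simp only [outside_polar]
      rfl) (by
      filter_upwards [hW₀] with y hy t v hyt
      obtain ⟨M, B, U, hU, hzU, hB⟩ := h.exists_local_equiv hσ (polar_mem_sector hy t)
      rw [hG y hy, hB _ _ hzU]
      simp only [outside_polar, hyt, not_false_eq_true, true_imp_iff]
      rw [← LinearEquiv.map_eq_zero_iff B.symm, funext_iff]
      rfl) (by
      filter_upwards [hW₀] with y hy t v hyt
      obtain ⟨M, B, U, hU, hzU, hB⟩ := h.exists_local_equiv hσ (polar_mem_sector hy t)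
      rw [hG y hy, hB _ _ hzU]
      simp only [outside_polar]
      exact fun c hc => (hc (hyt c)).elim)
  obtain ⟨B, hB⟩ := hN.exists_equiv
  obtain ⟨W, hW, hWo, hwW⟩ := eventually_nhds_iff.1 (hNG.and hW₀)
  have hle : (⟨W, hWo⟩ : Opens S1.{u}) ≤ W₀ := fun y hy => (hW y hy).2
  refine ⟨⟨W, hWo⟩, hwW, fun c => ModuleCat.of k (N c),
    res S.L (sector_mono hle) ∘ₗ σ ∘ₗ B.toLinearMap, fun c => ?_, ?_, ?_⟩
  · exact inferInstanceAs (Module.Finite k (N c))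
  · exact (hσ.comp B).res _
  · intro z hz m
    obtain ⟨y, t, rfl⟩ := exists_polar z
    have hy : y ∈ W := by
      have : proj (polar y t) ∈ W := hz
      rwa [proj_polar] at this
    rw [LinearMap.comp_apply, germ_res]
    refine (hG y (hle hy) t _).symm.trans (((hW y hy).1 t _).trans ((hB _ m).trans ?_))
    simp only [outside_polar]
    rfl

end SectorFrame

/-! ### Constant sheaves as graded pieces -/

section ConstantSheaf

variable {k : Type u} [Field k]

lemma exists_constant_sheaf (X : TopCat.{u}) (N : ModuleCat.{u} k) :
    ∃ (F : Sh k X) (σ : N →ₗ[k] Sec F ⊤), IsFrame σ := by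
  let P : TopCat.Presheaf (ModuleCat.{u} k) X := (Functor.const _).obj N
  let F : Sh k X := (presheafToSheaf (Opens.grothendieckTopology X) (ModuleCat.{u} k)).obj P
  let τ : P ⟶ F.presheaf := toSheafify (Opens.grothendieckTopology X) P
  refine ⟨F, (τ.app (op ⊤)).hom, fun x hx => ?_⟩
  have b1 : Function.Bijective ((TopCat.Presheaf.stalkFunctor (ModuleCat.{u} k) x).map τ).hom :=
    @ConcreteCategory.bijective_of_isIso _ _ _ _ _ _ _ _ _
      (TopCat.Presheaf.stalkFunctor_map_unit_toSheafify_isIso _ _ _)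
  have b2 : Function.Bijective (P.germ ⊤ x hx).hom := by
    constructor
    · intro m n e
      obtain ⟨W, _, iU, iV, e⟩ := P.germ_eq x hx hx m n e
      exact e
    · intro a
      obtain ⟨U, hU, s, rfl⟩ := P.exists_germ_eq a
      exact ⟨s, (P.germ_res_apply (homOfLE le_top) x hU s).symm⟩
  have key : (fun m : N => germ F ⊤ x hx ((τ.app (op ⊤)).hom m)) =
      ((TopCat.Presheaf.stalkFunctor (ModuleCat.{u} k) x).map τ).hom ∘ (P.germ ⊤ x hx).hom := by
    funext m
    exact (TopCat.Presheaf.stalkFunctor_map_germ_apply ⊤ x hx τ m).symm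
  rw [key]
  exact b1.comp b2

/-- Through the frames both sides become sheaves of locally constant functions with values in the
product of the `N c`, and both membership conditions become the vanishing of coordinates. -/
lemma IsStokesFrame.nonempty_gradedIsoOn {S : FilteredSheaf k} {E : Finset ℂ}
    {N : E → ModuleCat.{u} k} {U : Opens S1.{u}} {σ : (∀ c, N c) →ₗ[k] Sec S.L U}
    (h : IsStokesFrame S σ) {gr : E → Sh k S1.{u}} {τ : ∀ c, N c →ₗ[k] Sec (gr c) ⊤}
    (hτ : ∀ c, IsFrame (τ c)) : Nonempty (GradedIsoOn S gr U) := by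
  let e : ∀ V : Opens S1.{u}, V ≤ U → ((∀ c : E, Sec (gr c) V) ≃ₗ[k] Sec S.L V) := fun V hV =>
    (LinearEquiv.piCongrRight fun c => (hτ c).secEquiv V le_top).trans
      ((locallyConstantPiEquiv N).symm.trans (h.isFrame.secEquiv V hV).symm)
  have he : ∀ (V : Opens S1.{u}) hV t (x : V) (c : E),
      h.isFrame.secEquiv V hV (e V hV t) x c = (hτ c).secEquiv V le_top (t c) x := by
    intro V hV t x c
    simp only [e, LinearEquiv.trans_apply, LinearEquiv.apply_symm_apply]
    rfl
  refine ⟨⟨e, ?_, ?_⟩⟩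
  · intro V W hV hW t
    apply (h.isFrame.secEquiv W (hW.trans hV)).injective
    ext x c
    rw [he, h.isFrame.secEquiv_res hV hW, he, (hτ c).secEquiv_res le_top hW]
  · intro V hV ξ t
    rw [Subsheaf.mem_sec_iff]
    simp only [mem_sec_extByZero]
    have key : ∀ x (hx : x ∈ V), germ S.L V x hx (e V hV t) ∈ (S.fil ξ).stalk x ↔
        ∀ c : E, ¬ LtAt x c ξ → germ (gr c) V x hx (t c) = 0 := by
      intro x hx
      rw [← h.isFrame.germ_coord hV _ ⟨x, hx⟩, h.mem_iff]
      refine forall_congr' fun c => imp_congr_right fun _ => ?_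
      have := he V hV t ⟨x, hx⟩ c
      rw [h.isFrame.secEquiv_apply] at this
      rw [this, (hτ c).secEquiv_eq_iff, map_zero, map_zero]
    exact ⟨fun H c x hx => (key x hx).1 (H x hx) c, fun H x hx => (key x hx).2 fun c => H c x hx⟩

end ConstantSheaf

/-! ### The ranks of the graded pieces -/

section Rank

variable {k : Type u} [Field k]

instance : ConnectedSpace S1.{u} :=
  (Homeomorph.ulift.{u} (X := Circle)).symm.surjective.connectedSpace
    (Homeomorph.ulift.{u} (X := Circle)).symm.continuous

instance : Nontrivial S1.{u} := by
  refine ⟨⟨1⟩, ⟨Circle.exp Real.pi⟩, fun h => ?_⟩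
  have h' : ((1 : Circle) : ℂ) = (Circle.exp Real.pi : ℂ) :=
    congrArg (fun w : S1.{u} => (w.down : ℂ)) h
  rw [Circle.coe_exp, Complex.exp_pi_mul_I, Circle.coe_one] at h'
  norm_num at h'

/-- For `|w| = 1`, the vanishing of the real part of `(c - c') w⁻¹` means `w² = -(c - c') / conj (c
- c')`, which leaves at most two directions. -/
lemma finite_re_mul_inv_eq {c c' : ℂ} (h : c ≠ c') :
    {w : S1.{u} | (c * (w.down : ℂ)⁻¹).re = (c' * (w.down : ℂ)⁻¹).re}.Finite := by
  have hd : c - c' ≠ 0 := sub_ne_zero.2 h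
  have hconj : (starRingEnd ℂ) (c - c') ≠ 0 := (map_ne_zero _).2 hd
  refine Set.Finite.of_finite_image (f := fun w : S1.{u} => (w.down : ℂ)) ?_ fun w _ w' _ e =>
    ULift.ext _ _ (Circle.ext e)
  refine Set.Finite.subset (Polynomial.nthRoots 2
    (-(c - c') / (starRingEnd ℂ) (c - c'))).toFinset.finite_toSet ?_
  rintro _ ⟨w, hw, rfl⟩
  have hw : (c * (w.down : ℂ)⁻¹).re = (c' * (w.down : ℂ)⁻¹).re := hw
  simp only [Finset.mem_coe, Multiset.mem_toFinset]
  rw [Polynomial.mem_nthRoots two_pos, eq_div_iff hconj]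
  have h0 : ((c - c') * (w.down : ℂ)⁻¹).re = 0 := by
    rw [sub_mul, Complex.sub_re, hw, sub_self]
  have hw0 : (w.down : ℂ) ≠ 0 := Circle.coe_ne_zero _
  have hcw : (starRingEnd ℂ) (w.down : ℂ) = (w.down : ℂ)⁻¹ := by
    rw [← Circle.coe_inv_eq_conj, Circle.coe_inv]
  have h1 : (c - c') * (w.down : ℂ)⁻¹ + (starRingEnd ℂ) ((c - c') * (w.down : ℂ)⁻¹) = 0 := by
    rw [Complex.add_conj, h0]
    simp
  rw [map_mul, ← hcw, Complex.conj_conj, hcw] at h1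
  field_simp at h1
  linear_combination h1

/-- Points of `S¹` at which the exponents are pairwise distinct are dense. -/
lemma exists_generic (E : Finset ℂ) {U : Opens S1.{u}} {w : S1.{u}} (hw : w ∈ U) :
    ∃ v ∈ U, ∀ c ∈ E, ∀ c' ∈ E, (c * (v.down : ℂ)⁻¹).re = (c' * (v.down : ℂ)⁻¹).re → c = c' := by
  have hfin : (⋃ p ∈ (E ×ˢ E).filter fun p => p.1 ≠ p.2, {v : S1.{u} |
      (p.1 * (v.down : ℂ)⁻¹).re = (p.2 * (v.down : ℂ)⁻¹).re}).Finite := by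
    refine Set.Finite.biUnion (Finset.finite_toSet _) fun p hp => ?_
    exact finite_re_mul_inv_eq (Finset.mem_filter.1 hp).2
  have hinf : (U : Set S1.{u}).Infinite := infinite_of_mem_nhds w (U.2.mem_nhds hw)
  obtain ⟨v, hvU, hv⟩ := hinf.exists_notMem_finite hfin
  refine ⟨v, hvU, fun c hc c' hc' e => ?_⟩
  by_contra hne
  refine hv (Set.mem_biUnion (x := (c, c')) ?_ e)
  simp [hc, hc', hne]

/-- In a direction where the exponents are strictly ordered, the filtration is a flag with graded
pieces `M c`. The change of frame preserves the flag, so it induces injections `M c → M' c` on the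
graded pieces. -/
lemma IsStokesFrame.finrank_le {S : FilteredSheaf k} {E : Finset ℂ}
    {M M' : E → ModuleCat.{u} k} {U U' : Opens S1.{u}} {σ : (∀ c, M c) →ₗ[k] Sec S.L U}
    {σ' : (∀ c, M' c) →ₗ[k] Sec S.L U'} (h : IsStokesFrame S σ) (h' : IsStokesFrame S σ')
    [∀ c, Module.Finite k (M' c)] {w : S1.{u}} (hw : w ∈ U) (hw' : w ∈ U') (c : E) :
    Module.finrank k (M c) ≤ Module.finrank k (M' c) := by
  classical
  obtain ⟨v, ⟨hv, hv'⟩, hgen⟩ := exists_generic E (U := U ⊓ U') ⟨hw, hw'⟩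
  let A : (∀ c, M c) ≃ₗ[k] (∀ c, M' c) :=
    (h.isFrame.stalkEquiv v hv).trans (h'.isFrame.stalkEquiv v hv').symm
  have hA : ∀ (ξ : ℂ) m, (∀ c : E, ¬ LtAt v c ξ → m c = 0) ↔
      ∀ c : E, ¬ LtAt v c ξ → A m c = 0 := by
    intro ξ m
    rw [← h.mem_iff v hv ξ m, ← h'.mem_iff v hv' ξ (A m)]
    have : germ S.L U' v hv' (σ' (A m)) = germ S.L U v hv (σ m) :=
      h'.isFrame.germ_stalkEquiv_symm v hv' _
    rw [this]
  let f : M c →ₗ[k] M' c := LinearMap.proj c ∘ₗ A.toLinearMap ∘ₗ LinearMap.single k (fun c => M c) c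
  refine LinearMap.finrank_le_finrank_of_injective (f := f) ?_
  rw [injective_iff_map_eq_zero]
  intro x hx
  have hx : A (Pi.single c x) c = 0 := hx
  -- A level `t` just above `Re (c v⁻¹)`, with no other exponent in between: the subspace for `ξ = t
  -- v` contains the piece of `c` and nothing above it.
  obtain ⟨t, ht, ht'⟩ : ∃ t, ((c : ℂ) * (v.down : ℂ)⁻¹).re < t ∧ ∀ d : E,
      ((d : ℂ) * (v.down : ℂ)⁻¹).re < t →
        ((d : ℂ) * (v.down : ℂ)⁻¹).re ≤ ((c : ℂ) * (v.down : ℂ)⁻¹).re := by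
    have : ∀ᶠ t in nhdsWithin ((c : ℂ) * (v.down : ℂ)⁻¹).re
        (Set.Ioi ((c : ℂ) * (v.down : ℂ)⁻¹).re), ∀ d : E,
        ((d : ℂ) * (v.down : ℂ)⁻¹).re < t →
          ((d : ℂ) * (v.down : ℂ)⁻¹).re ≤ ((c : ℂ) * (v.down : ℂ)⁻¹).re := by
      rw [Filter.eventually_all]
      intro d
      by_cases hd : ((d : ℂ) * (v.down : ℂ)⁻¹).re ≤ ((c : ℂ) * (v.down : ℂ)⁻¹).re
      · exact Filter.Eventually.of_forall fun _ _ => hd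
      · filter_upwards [Ioo_mem_nhdsGT (not_le.1 hd)] with t ht ht'
        exact (ht.2.not_gt ht').elim
    obtain ⟨t, h1, h2⟩ := (this.and self_mem_nhdsWithin).exists
    exact ⟨t, h2, h1⟩
  have hv0 : (v.down : ℂ) ≠ 0 := Circle.coe_ne_zero _
  have hlt : ∀ d : E, LtAt v d (t * v.down) ↔ ((d : ℂ) * (v.down : ℂ)⁻¹).re < t := by
    intro d
    rw [LtAt, mul_inv_cancel_right₀ hv0, Complex.ofReal_re]
  have h1 : ∀ d : E, ¬ LtAt v d (t * v.down) → A (Pi.single c x) d = 0 := by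
    refine (hA _ _).1 fun d hd => Pi.single_eq_of_ne ?_ _
    rintro rfl
    exact hd ((hlt _).2 ht)
  -- If the `c`-component of the image of `x` vanishes, the image lies in the step strictly below
  -- `c`. Then so does `x`, hence `x = 0`.
  have h2 : ∀ d : E, ¬ LtAt v d c → A (Pi.single c x) d = 0 := by
    intro d hd
    by_cases hdt : LtAt v d (t * v.down)
    · have hle := ht' d ((hlt d).1 hdt)
      have heq : ((d : ℂ) * (v.down : ℂ)⁻¹).re = ((c : ℂ) * (v.down : ℂ)⁻¹).re :=
        le_antisymm hle (not_lt.1 hd)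
      have : d = c := Subtype.ext (hgen d d.2 c c.2 heq)
      rw [this]
      exact hx
    · exact h1 d hdt
  have := (hA _ _).2 h2 c (lt_irrefl _)
  simpa using this

/-- A filtered sheaf with adapted frames is graded by constant sheaves. -/
lemma exists_graded_of_frames {S : FilteredSheaf k} {E : Finset ℂ}
    (h : ∀ w : S1.{u}, ∃ U : Opens S1.{u}, w ∈ U ∧ ∃ (M : E → ModuleCat.{u} k)
      (σ : (∀ c, M c) →ₗ[k] Sec S.L U), (∀ c, Module.Finite k (M c)) ∧ IsStokesFrame S σ) :
    ∃ gr : E → Sh k S1.{u}, (∀ c, IsLocalSystem (gr c)) ∧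
      ∀ w : S1.{u}, ∃ U : Opens S1.{u}, w ∈ U ∧ Nonempty (GradedIsoOn S gr U) := by
  choose U hU M σ hM hσ using h
  have hrank : ∀ (c : E) (w w' : S1.{u}),
      Module.finrank k (M w c) = Module.finrank k (M w' c) := by
    intro c
    have : IsLocallyConstant fun w => Module.finrank k (M w c) := by
      rw [IsLocallyConstant.iff_exists_open]
      intro w
      refine ⟨U w, (U w).2, hU w, fun v hv => le_antisymm ?_ ?_⟩
      · exact (hσ v).finrank_le (hσ w) (hU v) hv c
      · exact (hσ w).finrank_le (hσ v) hv (hU v) c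
    exact fun w w' => this.apply_eq_of_preconnectedSpace w w'
  let w₀ : S1.{u} := ⟨1⟩
  -- The decompositions are only required locally, so the monodromy of the `gr c` is immaterial and
  -- constant sheaves of the right rank will do.
  choose gr τ hτ using fun c => exists_constant_sheaf S1.{u} (M w₀ c)
  refine ⟨gr, fun c => .of_frame fun w => ⟨⊤, trivial, M w₀ c, τ c, hM w₀ c, hτ c⟩, fun w => ?_⟩
  let e : (∀ c, M w₀ c) ≃ₗ[k] ∀ c, M w c := LinearEquiv.piCongrRight fun c =>
    LinearEquiv.ofFinrankEq _ _ (hrank c w₀ w)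
  have he : IsStokesFrame S (σ w ∘ₗ e.toLinearMap) := by
    refine ⟨(hσ w).isFrame.comp e, fun v hv ξ m => ((hσ w).mem_iff v hv ξ (e m)).trans ?_⟩
    refine forall_congr' fun c => imp_congr_right fun _ => ?_
    exact LinearEquiv.map_eq_zero_iff (LinearEquiv.ofFinrankEq _ _ (hrank c w₀ w))
  exact ⟨U w, hU w, he.nonempty_gradedIsoOn hτ⟩

end Rank

/-! ### From co-Stokes sheaves to co-Stokes structures -/

section Disassemble

variable {k : Type u} [Field k]

lemma le_map_circ_sector (r : Set.Ioi (0 : ℝ)) (U : Opens S1.{u}) :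
    U ≤ (Opens.map (circ r)).obj (sector U) := by
  intro w hw
  change proj (circ r w) ∈ U
  rwa [proj_circ]

/-- Restriction of sections over a sector to the circle of radius `r`. -/
def restrictSec (r : Set.Ioi (0 : ℝ)) (L : Sh k Cstar.{u}) (U : Opens S1.{u}) :
    Sec L (sector U) →ₗ[k] Sec ((pull k (circ r)).obj L) U :=
  res ((pull k (circ r)).obj L) (le_map_circ_sector r U) ∘ₗ pullSec (circ r) L (sector U)

lemma restrictSec_res (r : Set.Ioi (0 : ℝ)) (L : Sh k Cstar.{u}) {U V : Opens S1.{u}} (h : V ≤ U)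
    (s : Sec L (sector U)) : restrictSec r L V (res L (sector_mono h) s) =
      res ((pull k (circ r)).obj L) h (restrictSec r L U s) := by
  have h' : (Opens.map (circ r)).obj (sector V) ≤ (Opens.map (circ r)).obj (sector U) :=
    fun w hw => sector_mono h hw
  rw [restrictSec, restrictSec, LinearMap.comp_apply, LinearMap.comp_apply,
    pullSec_res (circ r) L (sector_mono h) h', res_res, res_res]

/-- Restriction of sections over sectors to the circle of radius `r`, as a morphism. -/
def restrictCircle (r : Set.Ioi (0 : ℝ)) (L : Sh k Cstar.{u}) :
    push L ⟶ (pull k (circ r)).obj L :=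
  ⟨{ app := fun U => ModuleCat.ofHom (restrictSec r L U.unop)
     naturality := fun U V f => by
      ext s
      exact restrictSec_res r L f.unop.le s }⟩

lemma germ_restrictSec (r : Set.Ioi (0 : ℝ)) (L : Sh k Cstar.{u}) {U : Opens S1.{u}}
    {w : S1.{u}} (hw : w ∈ U) (s : Sec L (sector U)) :
    germ ((pull k (circ r)).obj L) U w hw (restrictSec r L U s) =
      pullStalk (circ r) L w
        (germ L (sector U) (circ r w) (ray_subset_sector hw (circ_mem_ray r w)) s) := by
  rw [restrictSec, LinearMap.comp_apply, germ_res]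
  exact (pullStalk_germ (circ r) L w (sector U) _ _ s).symm

lemma onStalk_restrictCircle (r : Set.Ioi (0 : ℝ)) (L : Sh k Cstar.{u}) {U : Opens S1.{u}}
    {w : S1.{u}} (hw : w ∈ U) (s : Sec L (sector U)) :
    onStalk (restrictCircle r L) w (germ (push L) U w hw s) =
      pullStalk (circ r) L w
        (germ L (sector U) (circ r w) (ray_subset_sector hw (circ_mem_ray r w)) s) :=
  (onStalk_germ (restrictCircle r L) U w hw s).trans (germ_restrictSec r L hw s)

/-- A germ at the point of the circle extends to a sector, by a sector frame, and the extension is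
unique near the ray. Inverting this map is what extends sections along the rays. -/
lemma isIso_restrictCircle (r : Set.Ioi (0 : ℝ)) {L : Sh k Cstar.{u}} (hL : IsLocalSystem L) :
    IsIso (restrictCircle r L) := by
  refine isIso_of_onStalk_bijective _ fun w => ⟨fun a b e => ?_, fun a => ?_⟩
  · obtain ⟨U, hU, s, rfl⟩ := exists_germ (push L) w a
    obtain ⟨V, hV, t, rfl⟩ := exists_germ (push L) w b
    have e := (onStalk_restrictCircle r L hU s).symm.trans
      (e.trans (onStalk_restrictCircle r L hV t))
    exact hL.germ_push_eq (circ_mem_ray r w) ((pullStalk_bijective (circ r) L w).1 e)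
  · obtain ⟨b, rfl⟩ := (pullStalk_bijective (circ r) L w).2 a
    obtain ⟨W, hW, M, σ, -, hσ⟩ := hL.exists_sector_frame w
    obtain ⟨m, rfl⟩ := hσ.exists_eq (circ r w) (ray_subset_sector hW (circ_mem_ray r w)) b
    exact ⟨germ (push L) W w hW (σ m), onStalk_restrictCircle r L hW (σ m)⟩

/-- The extension of sections over the circle of radius `r` along the rays. -/
def extendRays (r : Set.Ioi (0 : ℝ)) {L : Sh k Cstar.{u}} (hL : IsLocalSystem L) :
    (pull k proj).obj ((pull k (circ r)).obj L) ⟶ L :=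
  have := isIso_restrictCircle r hL
  ((TopCat.Sheaf.pullbackPushforwardAdjunction (ModuleCat.{u} k) proj).homEquiv _ _).symm
    (inv (restrictCircle r L))

/-- The adjunction formula for the transpose of the inverse of `restrictCircle`, evaluated on a
section over a sector. -/
lemma onSec_extendRays (r : Set.Ioi (0 : ℝ)) {L : Sh k Cstar.{u}} (hL : IsLocalSystem L)
    (U : Opens S1.{u}) (s : Sec L (sector U)) :
    onSec (extendRays r hL) (sector U)
      (pullSec proj ((pull k (circ r)).obj L) U (restrictSec r L U s)) = s := by
  have := isIso_restrictCircle r hL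
  let adj := TopCat.Sheaf.pullbackPushforwardAdjunction (ModuleCat.{u} k) proj.{u}
  have h : adj.unit.app _ ≫ (TopCat.Sheaf.pushforward _ proj).map (extendRays r hL) =
      inv (restrictCircle r L) :=
    (adj.homEquiv_unit _ _ _).symm.trans (Equiv.apply_symm_apply _ _)
  have h' : restrictCircle r L ≫ adj.unit.app _ ≫
      (TopCat.Sheaf.pushforward _ proj).map (extendRays r hL) = 𝟙 _ := by
    rw [h, IsIso.hom_inv_id]
  exact congrArg (fun g => onSec g U s) h'

/-- `extendRays` is the identification of the stalks along the rays. -/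
lemma onStalk_extendRays (r : Set.Ioi (0 : ℝ)) {L : Sh k Cstar.{u}} (hL : IsLocalSystem L)
    (z : Cstar.{u}) (U : Opens Cstar.{u}) (hU : ray (proj z) ⊆ U) (s : Sec L U) :
    onStalk (extendRays r hL) z (pullStalk proj ((pull k (circ r)).obj L) z
      (pullStalk (circ r) L (proj z) (germ L U (circ r (proj z)) (hU (circ_mem_ray r _)) s))) =
      germ L U z (hU rfl) s := by
  obtain ⟨W, hW, M, σ, -, hσ⟩ := hL.exists_sector_frame (proj z)
  have hray := ray_subset_sector hW
  obtain ⟨m, hm⟩ := hσ.exists_eq (circ r (proj z)) (hray (circ_mem_ray r _))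
    (germ L U (circ r (proj z)) (hU (circ_mem_ray r _)) s)
  have hm' : germ L (sector W) z hW (σ m) = germ L U z (hU rfl) s :=
    hL.germ_eq_of_isPreconnected (isPreconnected_ray _) hray hU (circ_mem_ray r _) hm rfl
  rw [← hm, ← germ_restrictSec r L hW (σ m), ← hm']
  refine (congrArg _ (pullStalk_germ proj _ z W hW hW _)).trans ?_
  exact (onStalk_germ (extendRays r hL) (sector W) z hW _).trans
    (congrArg _ (onSec_extendRays r hL W (σ m)))

lemma exists_extension (r : Set.Ioi (0 : ℝ)) {L : Sh k Cstar.{u}} (hL : IsLocalSystem L)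
    (w : S1.{u}) (a : Stalk ((pull k (circ r)).obj L) w) :
    ∃ (U : Opens Cstar.{u}) (hU : ray w ⊆ U) (s : Sec L U),
      pullStalk (circ r) L w (germ L U (circ r w) (hU (circ_mem_ray r w)) s) = a := by
  obtain ⟨b, rfl⟩ := (pullStalk_bijective (circ r) L w).2 a
  obtain ⟨W, hW, M, σ, -, hσ⟩ := hL.exists_sector_frame w
  obtain ⟨m, rfl⟩ := hσ.exists_eq (circ r w) (ray_subset_sector hW (circ_mem_ray r w)) b
  exact ⟨sector W, ray_subset_sector hW, σ m, rfl⟩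

lemma isIso_extendRays (r : Set.Ioi (0 : ℝ)) {L : Sh k Cstar.{u}} (hL : IsLocalSystem L) :
    IsIso (extendRays r hL) := by
  refine isIso_of_onStalk_bijective _ fun z => ⟨fun a b e => ?_, fun a => ?_⟩
  · obtain ⟨a, rfl⟩ := (pullStalk_bijective proj _ z).2 a
    obtain ⟨b, rfl⟩ := (pullStalk_bijective proj _ z).2 b
    obtain ⟨U, hU, s, rfl⟩ := exists_extension r hL _ a
    obtain ⟨V, hV, t, rfl⟩ := exists_extension r hL _ b
    rw [onStalk_extendRays, onStalk_extendRays] at e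
    have := hL.germ_eq_of_isPreconnected (isPreconnected_ray _) hU hV rfl e (circ_mem_ray r _)
    rw [this]
  · obtain ⟨W, hW, M, σ, -, hσ⟩ := hL.exists_sector_frame (proj z)
    obtain ⟨m, rfl⟩ := hσ.exists_eq z hW a
    exact ⟨_, onStalk_extendRays r hL z (sector W) (ray_subset_sector hW) (σ m)⟩

/-- Extensions of a germ along the connected ray are unique, so the existential in `transported` can
be tested on any extension. -/
lemma pullStalk_mem_subAt (r : Set.Ioi (0 : ℝ)) {S : SheafPair k} (hL : IsLocalSystem S.L)
    (ξ : ℂ) (w : S1.{u}) (U : Opens Cstar.{u}) (hU : ray w ⊆ U) (s : Sec S.L U) :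
    pullStalk (circ r) S.L w (germ S.L U (circ r w) (hU (circ_mem_ray r w)) s) ∈ subAt r S ξ w ↔
      germ S.L U (param ξ w) (hU (param_mem_ray ξ w)) s ∈ S.G.stalk (param ξ w) := by
  constructor
  · rintro ⟨_, ⟨V, hV, t, rfl, ht⟩, e⟩
    have e := (pullStalk_bijective (circ r) S.L w).1 e
    rwa [hL.germ_eq_of_isPreconnected (isPreconnected_ray w) hV hU (circ_mem_ray r w) e
      (param_mem_ray ξ w)] at ht
  · exact fun h => ⟨_, ⟨U, hU, s, rfl, h⟩, rfl⟩

lemma IsFrame.restrictSec {L : Sh k Cstar.{u}} {W : Opens S1.{u}} {M : Type u}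
    [AddCommGroup M] [Module k M] {σ : M →ₗ[k] Sec L (sector W)} (h : IsFrame σ)
    (r : Set.Ioi (0 : ℝ)) : IsFrame (CoStokes.restrictSec r L W ∘ₗ σ) := by
  intro w hw
  have : (fun m => germ ((CoStokes.pull k (circ r)).obj L) W w hw
      ((CoStokes.restrictSec r L W ∘ₗ σ) m)) =
      pullStalk (circ r) L w ∘ fun m =>
        germ L (sector W) (circ r w) (ray_subset_sector hw (circ_mem_ray r w)) (σ m) := by
    funext m
    exact germ_restrictSec r L hw (σ m)
  rw [this]
  exact (pullStalk_bijective (circ r) L w).comp (h _ _)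

lemma IsPairFrame.germ_mem_subAt {S : SheafPair k} (hL : IsLocalSystem S.L) {E : Finset ℂ}
    {M : E → ModuleCat.{u} k} {W : Opens S1.{u}} {σ : (∀ c, M c) →ₗ[k] Sec S.L (sector W)}
    (h : IsPairFrame S σ) (r : Set.Ioi (0 : ℝ)) (ξ : ℂ) (w : S1.{u}) (hw : w ∈ W)
    (m : ∀ c, M c) :
    germ ((pull k (circ r)).obj S.L) W w hw ((restrictSec r S.L W ∘ₗ σ) m) ∈
      subAt r S ξ w ↔ ∀ c : E, w ∉ {w | LtAt w c ξ} → m c = 0 := by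
  rw [LinearMap.comp_apply, germ_restrictSec, pullStalk_mem_subAt r hL, h.mem_iff]
  simp only [outside_iff_of_mem_curve (param_mem_curve ξ w)]
  have key : ∀ v : S1.{u}, v = w →
      ((∀ c : E, ¬ LtAt v c ξ → m c = 0) ↔ ∀ c : E, w ∉ {w | LtAt w c ξ} → m c = 0) := by
    rintro _ rfl
    exact Iff.rfl
  exact key _ (proj_param ξ w)

/-- The dictionary in the other direction: at `i_ξ(w)`, the condition `S_c < z` is `c <_w ξ`, which
is open in `w`. -/
lemma IsPairFrame.disassemble {S : SheafPair k} (hL : IsLocalSystem S.L) {E : Finset ℂ}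
    {M : E → ModuleCat.{u} k} {W : Opens S1.{u}} {σ : (∀ c, M c) →ₗ[k] Sec S.L (sector W)}
    (h : IsPairFrame S σ) (r : Set.Ioi (0 : ℝ)) :
    IsStokesFrame (CoStokes.disassemble r S) (restrictSec r S.L W ∘ₗ σ) where
  isFrame := h.isFrame.restrictSec r
  mem_iff w hw ξ m := isFrame_mem_stalk_ofStalks (fun c : E => isOpen_ltAt (c : ℂ) ξ)
    (h.germ_mem_subAt hL r ξ) w hw m

lemma SheafPair.IsCoStokesSheaf.stalk_disassemble {S : SheafPair k} {E : Finset ℂ}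
    (h : S.IsCoStokesSheaf E) (r : Set.Ioi (0 : ℝ)) (ξ : ℂ) (w : S1.{u}) :
    ((disassemble r S).fil ξ).stalk w = subAt r S ξ w := by
  obtain ⟨W, hW, M, σ, -, hσ⟩ := h.exists_sector_frame w
  have hf := hσ.disassemble h.isLocalSystem r
  ext a
  obtain ⟨m, rfl⟩ := hf.isFrame.exists_eq w hW a
  rw [hf.mem_iff w hW]
  exact (hσ.germ_mem_subAt h.isLocalSystem r ξ w hW m).symm

lemma SheafPair.IsCoStokesSheaf.isCoStokes {S : SheafPair k} {E : Finset ℂ}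
    (h : S.IsCoStokesSheaf E) (r : Set.Ioi (0 : ℝ)) : (disassemble r S).IsCoStokes E where
  isLocalSystem := h.isLocalSystem.pull (circ r)
  stalk_mono w ξ₁ ξ₂ hlt := by
    obtain ⟨W, hW, M, σ, -, hσ⟩ := h.exists_sector_frame w
    have hf := hσ.disassemble h.isLocalSystem r
    intro a ha
    obtain ⟨m, rfl⟩ := hf.isFrame.exists_eq w hW a
    rw [hf.mem_iff] at ha ⊢
    exact fun c hc => ha c fun hc' => hc (lt_trans hc' hlt)
  graded := exists_graded_of_frames fun w => by
    obtain ⟨W, hW, M, σ, hM, hσ⟩ := h.exists_sector_frame w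
    exact ⟨W, hW, M, _, hM, hσ.disassemble h.isLocalSystem r⟩

/-- For `ξ` with `z ∈ S_ξ`, that is `z = i_ξ(π z)`, both sides say that the extension along the ray
has its germ at `z` in `G`. The equivalence shows that `extendRays` and its inverse both respect the
subsheaves. -/
lemma onStalk_extendRays_mem {S : SheafPair k} {E : Finset ℂ} (h : S.IsCoStokesSheaf E)
    (r : Set.Ioi (0 : ℝ)) (z : Cstar.{u})
    (a : Stalk ((pull k proj).obj ((pull k (circ r)).obj S.L)) z) :
    onStalk (extendRays r h.isLocalSystem) z a ∈ S.G.stalk z ↔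
      a ∈ (assemble (disassemble r S)).G.stalk z := by
  obtain ⟨ξ, hξ⟩ := exists_mem_curve z
  obtain ⟨a, rfl⟩ := (pullStalk_bijective proj _ z).2 a
  obtain ⟨U, hU, s, rfl⟩ := exists_extension r h.isLocalSystem _ a
  rw [onStalk_extendRays, (h.isCoStokes r).stalk_assemble hξ]
  refine Iff.trans ?_ (pullStalk_mem_filAt (S := disassemble r S) _).symm
  rw [h.stalk_disassemble]
  refine Iff.trans ?_ (pullStalk_mem_subAt r h.isLocalSystem ξ (proj z) U hU s).symm
  have hz := eq_param_of_mem_curve hξ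
  have key : ∀ z', z = z' → ∀ (h1 : z ∈ U) (h2 : z' ∈ U),
      germ S.L U z h1 s ∈ S.G.stalk z ↔ germ S.L U z' h2 s ∈ S.G.stalk z' := by
    rintro _ rfl _ _
    rfl
  exact key _ hz _ _

lemma extendRays_map_sub {S : SheafPair k} {E : Finset ℂ} (h : S.IsCoStokesSheaf E)
    (r : Set.Ioi (0 : ℝ)) (U : Opens Cstar.{u}) (s : Sec (assemble (disassemble r S)).L U)
    (hs : s ∈ (assemble (disassemble r S)).G.sec U) :
    onSec (extendRays r h.isLocalSystem) U s ∈ S.G.sec U := by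
  refine S.G.mem_sec_iff.2 fun z hz => ?_
  refine (onStalk_germ (extendRays r h.isLocalSystem) U z hz s) ▸ ?_
  exact (onStalk_extendRays_mem h r z _).2
    ((assemble (disassemble r S)).G.germ_mem_stalk hs z hz)

lemma inv_map_sub {S : SheafPair k} {E : Finset ℂ} (h : S.IsCoStokesSheaf E)
    (r : Set.Ioi (0 : ℝ)) {g : S.L ⟶ (assemble (disassemble r S)).L}
    (hg : g ≫ extendRays r h.isLocalSystem = 𝟙 _) (U : Opens Cstar.{u}) (s : Sec S.L U)
    (hs : s ∈ S.G.sec U) : onSec g U s ∈ (assemble (disassemble r S)).G.sec U := by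
  refine (assemble (disassemble r S)).G.mem_sec_iff.2 fun z hz => ?_
  refine (onStalk_germ g U z hz s) ▸ (onStalk_extendRays_mem h r z _).1 ?_
  have e : onStalk (extendRays r h.isLocalSystem) z (onStalk g z (germ S.L U z hz s)) =
      germ S.L U z hz s := by
    refine (onStalk_comp g (extendRays r h.isLocalSystem) z _).symm.trans ?_
    rw [hg, onStalk_id]
  rw [e]
  exact S.G.germ_mem_stalk hs z hz

/-- Assembly after disassembly gives back a co-Stokes sheaf. -/
def assembleDisassembleIso {S : SheafPair k} {E : Finset ℂ} (h : S.IsCoStokesSheaf E)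
    (r : Set.Ioi (0 : ℝ)) : assemble (disassemble r S) ≅ S :=
  have := isIso_extendRays r h.isLocalSystem
  let e := asIso (extendRays r h.isLocalSystem)
  { hom := ⟨extendRays r h.isLocalSystem, extendRays_map_sub h r⟩
    inv := ⟨e.inv, inv_map_sub h r e.inv_hom_id⟩
    hom_inv_id := SheafPair.Hom.ext e.hom_inv_id
    inv_hom_id := SheafPair.Hom.ext e.inv_hom_id }

end Disassemble

section QuasiInverse

/-! ### Quasi-inverses of fully faithful functors from preimages of objects -/

universe v₁ v₂ u₁ u₂

variable {C : Type u₁} [Category.{v₁} C] {D : Type u₂} [Category.{v₂} D] (F : C ⥤ D) [F.Full]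
  [F.Faithful] (G : D → C) (ε : ∀ X, F.obj (G X) ≅ X)

/-- The functor given on objects by preimages `G X` of the objects `X` under a fully faithful
functor. -/
def preimageFunctor : D ⥤ C where
  obj := G
  map {X Y} f := F.preimage ((ε X).hom ≫ f ≫ (ε Y).inv)
  map_id X := F.map_injective (by simp)
  map_comp f g := F.map_injective (by simp)

lemma map_preimageFunctor_map {X Y : D} (f : X ⟶ Y) :
    F.map ((preimageFunctor F G ε).map f) ≫ (ε Y).hom = (ε X).hom ≫ f := by
  simp [preimageFunctor]

/-- A fully faithful functor and a choice of preimages of the objects give an equivalence. -/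
def preimageEquivalence : C ≌ D :=
  CategoryTheory.Equivalence.mk F (preimageFunctor F G ε)
    (NatIso.ofComponents (fun X => F.preimageIso (ε (F.obj X)).symm)
      fun f => F.map_injective (by simp [preimageFunctor]))
    (NatIso.ofComponents ε fun f => map_preimageFunctor_map F G ε f)

end QuasiInverse

/-! ### The functor `τ` and the equivalence -/

section Tau

variable {k : Type u} [Field k]

lemma assembleFunctor_isCoStokesSheaf (E : Finset ℂ) (S : FilteredSheaf k) (h : S.IsCoStokes E) :
    ((assembleFunctor k).obj S).IsCoStokesSheaf E :=
  h.isCoStokesSheaf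

lemma exists_proj_eq (w : S1.{u}) : ∃ z : Cstar.{u}, proj z = w :=
  ⟨_, proj_param 0 w⟩

/-- Disassembly of the objects of `SSh`. -/
def disassembleObj (r : SSh k → Set.Ioi (0 : ℝ)) (X : SSh k) : Sto k :=
  ⟨disassemble (r X) X.obj, X.property.choose, X.property.choose_spec.isCoStokes (r X)⟩

/-- The isomorphism `σ τ X ≅ X`. -/
def sigmaDisassembleIso (r : SSh k → Set.Ioi (0 : ℝ)) (X : SSh k) :
    (sigma assembleFunctor_isCoStokesSheaf).obj (disassembleObj r X) ≅ X :=
  ObjectProperty.isoMk _ (assembleDisassembleIso X.property.choose_spec (r X))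

/-- The quasi-inverse `τ` of `σ`. -/
def tau (r : SSh k → Set.Ioi (0 : ℝ)) : SSh k ⥤ Sto k :=
  preimageFunctor (sigma assembleFunctor_isCoStokesSheaf) (disassembleObj r)
    (sigmaDisassembleIso r)

/-- The equivalence given by `σ` and `τ`. -/
def sigmaEquivalence (r : SSh k → Set.Ioi (0 : ℝ)) : Sto k ≌ SSh k :=
  preimageEquivalence (sigma assembleFunctor_isCoStokesSheaf) (disassembleObj r)
    (sigmaDisassembleIso r)

/-- Naturality of `σ τ X ≅ X` on the underlying sheaves. It determines `τ f`. -/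
lemma pull_map_tau_map (r : SSh k → Set.Ioi (0 : ℝ)) {X Y : SSh k} (f : X ⟶ Y) :
    (pull k proj).map ((tau r).map f).hom.hom ≫
        extendRays (r Y) Y.property.choose_spec.isLocalSystem =
      extendRays (r X) X.property.choose_spec.isLocalSystem ≫ f.hom.hom :=
  congrArg (fun g => g.hom.hom)
    (map_preimageFunctor_map (sigma assembleFunctor_isCoStokesSheaf) (disassembleObj r)
      (sigmaDisassembleIso r) f)

/-- At a point `z` of the ray, `pullStalk proj` followed by `extendRays` is injective and takes both
sides to the germ of `f s` at `z`. -/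
lemma onStalk_eq_of_pull_map_comp_extendRays {r r' : Set.Ioi (0 : ℝ)} {L L' : Sh k Cstar.{u}}
    (hL : IsLocalSystem L) (hL' : IsLocalSystem L') {f : L ⟶ L'}
    {g : (pull k (circ r)).obj L ⟶ (pull k (circ r')).obj L'}
    (h : (pull k proj).map g ≫ extendRays r' hL' = extendRays r hL ≫ f) (w : S1.{u})
    (U : Opens Cstar.{u}) (hU : ray w ⊆ U) (s : Sec L U) :
    onStalk g w (pullStalk (circ r) L w (germ L U (circ r w) (hU (circ_mem_ray _ w)) s)) =
      pullStalk (circ r') L' w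
        (germ L' U (circ r' w) (hU (circ_mem_ray _ w)) (onSec f U s)) := by
  obtain ⟨z, rfl⟩ := exists_proj_eq w
  have := isIso_extendRays r' hL'
  have inj : Function.Injective (onStalk (extendRays r' hL') z) := fun a b e => by
    have e' := congrArg (onStalk (inv (extendRays r' hL')) z) e
    rwa [← onStalk_comp, ← onStalk_comp, IsIso.hom_inv_id, onStalk_id, onStalk_id] at e'
  refine (pullStalk_bijective proj ((pull k (circ r')).obj L') z).1 (inj ?_)
  rw [onStalk_extendRays r' hL' z U hU, ← onStalk_pullStalk, ← onStalk_comp, h, onStalk_comp,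
    onStalk_extendRays r hL z U hU, onStalk_germ]

lemma isCircleRestriction_tau (r : SSh k → Set.Ioi (0 : ℝ)) : IsCircleRestriction r (tau r) := by
  refine ⟨fun X => Iso.refl _, fun {X Y} f w U hU s => ?_⟩
  refine Eq.trans ?_ (onStalk_eq_of_pull_map_comp_extendRays _ _
    (pull_map_tau_map r f) w U hU s)
  have e : (Iso.refl (disassemble (r X) X.obj)).inv ≫ ((tau r).map f).hom ≫
      (Iso.refl (disassemble (r Y) Y.obj)).hom = ((tau r).map f).hom :=
    (Category.id_comp _).trans (Category.comp_id _)
  exact congrArg (fun g => onStalk (FilteredSheaf.Hom.hom g) w _) e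

end Tau

end CoStokes

end

open CoStokes

theorem mainTheorem2 {k : Type u} [Field k] :
    ∃ hσ : ∀ (E : Finset ℂ) (S : FilteredSheaf k),
        S.IsCoStokes E → ((assembleFunctor k).obj S).IsCoStokesSheaf E,
      -- the stalk of `𝒢` at `z ∈ S_ξ` is `𝓛_{<ξ,θ}`
      (∀ (S : Sto k) (ξ : ℂ), ∀ z ∈ curve.{u} ξ,
        ((sigma hσ).obj S).obj.G.stalk z = filAt S.obj ξ z) ∧
      -- `σ` is an equivalence of categories
      (sigma hσ).IsEquivalence ∧
      -- restriction to the circles gives a co-Stokes structure with the same exponents, and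
      -- the stalk of its `ξ`-th subsheaf at `θ` is `𝒢_{i_ξ(θ)}`
      (∀ (E : Finset ℂ) (S : SheafPair k) (r : Set.Ioi (0 : ℝ)), S.IsCoStokesSheaf E →
        Encircles.{u} r E → (disassemble r S).IsCoStokes E ∧
          ∀ (ξ : ℂ) (w : S1.{u}), ((disassemble r S).fil ξ).stalk w = subAt r S ξ w) ∧
      -- it is a functor `τ` (for any choice of circles `S_∞`), and is quasi-inverse to `σ`
      ∀ r : SSh k → Set.Ioi (0 : ℝ),
        (∀ X : SSh k, ∃ E, X.obj.IsCoStokesSheaf E ∧ Encircles.{u} (r X) E) →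
          ∃ τ : SSh k ⥤ Sto k, IsCircleRestriction r τ ∧
            ∃ e : Sto k ≌ SSh k, e.functor = sigma hσ ∧ e.inverse = τ := by

  refine ⟨assembleFunctor_isCoStokesSheaf, fun S ξ z hz => ?_, ?_, fun E S r h _ => ?_,
    fun r _ => ⟨tau r, isCircleRestriction_tau r, sigmaEquivalence r, rfl, rfl⟩⟩
  · obtain ⟨E, hE⟩ := S.property
    exact hE.stalk_assemble hz
  -- That `σ` is an equivalence does not refer to circles; radius `1` is an arbitrary choice.
  · exact (sigmaEquivalence (k := k) fun _ => ⟨1, Set.mem_Ioi.2 one_pos⟩).isEquivalence_functor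
  · exact ⟨h.isCoStokes r, h.stalk_disassemble r⟩
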